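/- Let $\Lambda_j=[-j,j]^4\cap\mathbb Z^4$ with free or zero (Dirichlet) boundary condition, and let $\langle\cdot\rangle_{\beta}$ be the expectation of Villain $U(1)$ lattice gauge theory at inverse temperature $\beta>0$, i.e. the angles $\theta(e)\in[-\pi,\pi)$ on the positively oriented edges of $\Lambda_j$ (extended by $\theta(e^{-1})=-\theta(e)$; for the zero boundary condition $\theta=0$ on the edges contained in the boundary of the cube) have density proportional to $$\prod_{f}\sum_{m\in\mathbb Z}\exp\Big(-\tfrac{\beta}{2}\big(2\pi m+\mathrm d\theta(f)\big)^2\Big)$$ with respect to Lebesgue measure, where $f$ runs over the plaquettes of $\Lambda_j$ (for the zero boundary condition, those not contained in the boundary) and $\mathrm d\theta(f)$ is the oriented sum of $\theta$ around $f$. An infinite-volume theory on $\mathbb Z^4$ is any limit in law of these measures along a subsequence $j\to\infty$. For an axis-parallel lattice rectangle $R$ with side lengths $L,H\ge 1$ and boundary loop $\gamma$, let $|\gamma|=2(L+H)$ and $W_\gamma=\prod_{e\in\gamma}e^{i\theta(e)}$. Let $G$ be the Green's function (expected number of visits) of the simple random walk on $\mathbb Z^4$ divided by the degree $8$, and $C_{GFF}=\sum_{k\in\mathbb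 Z}G(0,ke_1)$. Then: (0) $C_{GFF}<\infty$. (1) For every $\beta>0$ there is $c=c(\beta)>0$ such that $|\langle W_\gamma\rangle_\beta|\le \exp(-c\,|\gamma|)$ for every such loop $\gamma$, in every $\Lambda_j$ containing $R$ with the free boundary condition, in every $\Lambda_j$ containing $R$ off its boundary with the zero boundary condition, and in every infinite-volume theory on $\mathbb Z^4$. (2) The decay rate is asymptotically at least $C_{GFF}/(2\beta)$: there is an absolute constant $K$ such that for every $\beta>0$ and every rectangle $R$ with $L^{3/4}\le H\le L^{4/3}$, $$|\langle W_\gamma\rangle_\beta|\le\exp\Big(-\frac{C_{GFF}}{2\beta}\big(|\gamma|-K L^{2/3}\big)\Big),$$ in every $\Lambda_j$, with either boundary condition, such that $R$ is contained in $\Lambda_j$ at distance more than $L$ from its boundary, and in every infinite-volume theory on $\mathbb Z^4$. -/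

import Mathlib

open MeasureTheory Filter Topology
open scoped ENNReal BoundedContinuousFunction

namespace VillainU1

/-- Vertices of the lattice `ℤ⁴`. -/
abbrev Site : Type := Fin 4 → ℤ

/-- The canonical basis vector `e_i`. -/
def unit (i : Fin 4) : Site := Pi.single i 1

/-- Positively oriented edges of `ℤ⁴`: `(x, i)` is the edge from `x` to `x + e_i`. A `1`-form
(antisymmetric under reversal) is identified with its values on positively oriented edges. -/
abbrev Edge : Type := Site × Fin 4

/-- Positively oriented plaquettes of `ℤ⁴`: for `i < k`, `(x, i, k)` is the unit square based at
`x` and spanned by `e_i` and `e_k`. Triples that violate `i < k` are discarded below. -/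
abbrev Plaquette : Type := Site × Fin 4 × Fin 4

/-- The vertices of the cube `Λ_j = [-j, j]⁴`. -/
noncomputable def boxSites (j : ℕ) : Finset Site := Fintype.piFinset fun _ => Finset.Icc (-(j : ℤ)) (j : ℤ)

/-- The edges of `Λ_j`. -/
noncomputable def boxEdges (j : ℕ) : Finset Edge :=
  (boxSites j ×ˢ Finset.univ).filter fun e => e.1 + unit e.2 ∈ boxSites j

/-- The plaquettes of `Λ_j`. -/
noncomputable def boxPlaquettes (j : ℕ) : Finset Plaquette :=
  (boxSites j ×ˢ (Finset.univ ×ˢ Finset.univ)).filter fun f =>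
    f.2.1 < f.2.2 ∧ f.1 + unit f.2.1 + unit f.2.2 ∈ boxSites j

/-- An edge of `Λ_j` that is entirely contained in the boundary of the cube `[-j, j]⁴`. -/
def IsBoundaryEdge (j : ℕ) (e : Edge) : Prop := ∃ k, k ≠ e.2 ∧ |e.1 k| = (j : ℤ)

/-- A plaquette of `Λ_j` that is entirely contained in the boundary of the cube `[-j, j]⁴`. -/
def IsBoundaryPlaquette (j : ℕ) (f : Plaquette) : Prop :=
  ∃ k, k ≠ f.2.1 ∧ k ≠ f.2.2 ∧ |f.1 k| = (j : ℤ)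

/-- The two boundary conditions: free, and zero (Dirichlet). -/
inductive BoundaryCondition
  | free
  | zero

open Classical in
/-- The edges carrying a random angle. With zero boundary condition the `1`-form vanishes on the
boundary edges. -/
noncomputable def activeEdges (j : ℕ) : BoundaryCondition → Finset Edge
  | .free => boxEdges j
  | .zero => (boxEdges j).filter fun e => ¬ IsBoundaryEdge j e

open Classical in
/-- The plaquettes carrying a Villain weight. With zero boundary condition `dθ` and the integer
`2`-form both vanish on the boundary plaquettes. -/
noncomputable def activePlaquettes (j : ℕ) : BoundaryCondition → Finset Plaquette
  | .free => boxPlaquettes j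
  | .zero => (boxPlaquettes j).filter fun f => ¬ IsBoundaryPlaquette j f

/-- The exterior derivative `dθ(f)`, the oriented sum of `θ` along the boundary of `f`. -/
def dOne (θ : Edge → ℝ) (f : Plaquette) : ℝ :=
  θ (f.1, f.2.1) + θ (f.1 + unit f.2.1, f.2.2) - θ (f.1 + unit f.2.2, f.2.1) - θ (f.1, f.2.2)

/-- The Villain weight `∏_f ∑_{m ∈ ℤ} exp (-(β/2) (2π m + dθ(f))²)`. -/
noncomputable def villainWeight (β : ℝ) (bc : BoundaryCondition) (j : ℕ) (θ : Edge → ℝ) : ℝ :=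
  ∏ f ∈ activePlaquettes j bc,
    ∑' m : ℤ, Real.exp (-(β / 2) * (2 * Real.pi * (m : ℝ) + dOne θ f) ^ 2)

/-- Extension by `0` of a family of angles indexed by a finite set of edges. -/
noncomputable def extendByZero (S : Finset Edge) (θ : S → ℝ) : Edge → ℝ :=
  fun e => if h : e ∈ S then θ ⟨e, h⟩ else 0

/-- Lebesgue measure on `[-π, π)^S`, seen as a measure on `1`-forms on `ℤ⁴` vanishing off `S`. -/
noncomputable def angleMeasure (S : Finset Edge) : Measure (Edge → ℝ) :=
  (Measure.pi fun _ : S => (volume : Measure ℝ).restrict (Set.Ico (-Real.pi) Real.pi)).map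
    (extendByZero S)

/-- The unnormalised Villain measure on `Λ_j`. -/
noncomputable def villainUnnormalised (β : ℝ) (bc : BoundaryCondition) (j : ℕ) :
    Measure (Edge → ℝ) :=
  (angleMeasure (activeEdges j bc)).withDensity fun θ => ENNReal.ofReal (villainWeight β bc j θ)

/-- The Villain `U(1)` lattice gauge theory on `Λ_j` at inverse temperature `β`: the law of the
angles `θ`, a probability measure for `β > 0`. -/
noncomputable def villain (β : ℝ) (bc : BoundaryCondition) (j : ℕ) : Measure (Edge → ℝ) :=
  (villainUnnormalised β bc j Set.univ)⁻¹ • villainUnnormalised β bc j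

/-- `P` is an infinite-volume Villain `U(1)` lattice gauge theory on `ℤ⁴`: a limit in law of the
measures on `Λ_j` along some subsequence `j → ∞`. -/
def IsInfiniteVolumeVillain (β : ℝ) (bc : BoundaryCondition) (P : Measure (Edge → ℝ)) : Prop :=
  IsProbabilityMeasure P ∧ ∃ φ : ℕ → ℕ, StrictMono φ ∧
    ∀ F : (Edge → ℝ) →ᵇ ℝ,
      Tendsto (fun n => ∫ θ, F θ ∂(villain β bc (φ n))) atTop (𝓝 (∫ θ, F θ ∂P))

/-- A non-degenerate lattice rectangle parallel to the axes: side lengths `L` in direction `e_a`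
and `H` in direction `e_b`. -/
structure Rectangle where
  corner : Site
  a : Fin 4
  b : Fin 4
  a_ne_b : a ≠ b
  L : ℕ
  H : ℕ
  L_pos : 0 < L
  H_pos : 0 < H

namespace Rectangle

/-- The lattice point of `R` with internal coordinates `(s, t)`. -/
def point (R : Rectangle) (s t : ℕ) : Site :=
  R.corner + (s : ℤ) • unit R.a + (t : ℤ) • unit R.b

/-- The length of the boundary loop `γ` of `R`. -/
def perimeter (R : Rectangle) : ℕ := 2 * (R.L + R.H)

/-- The Wilson loop observable `W_γ = ∏_{e ∈ γ} exp (i θ(e))`, for the boundary loop `γ` of `R`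
run through starting with the side at `corner` in direction `e_a`. The last two sides are
traversed against the positive orientation. -/
noncomputable def wilson (R : Rectangle) (θ : Edge → ℝ) : ℂ :=
  (∏ s ∈ Finset.range R.L, Complex.exp (Complex.I * θ (R.point s 0, R.a))) *
  (∏ t ∈ Finset.range R.H, Complex.exp (Complex.I * θ (R.point R.L t, R.b))) *
  (∏ s ∈ Finset.range R.L, Complex.exp (-(Complex.I * θ (R.point s R.H, R.a)))) *
  (∏ t ∈ Finset.range R.H, Complex.exp (-(Complex.I * θ (R.point 0 t, R.b))))

/-- `R` is contained in `Λ_j`. -/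
def InBox (R : Rectangle) (j : ℕ) : Prop :=
  ∀ s ≤ R.L, ∀ t ≤ R.H, R.point s t ∈ boxSites j

/-- `R` is contained in `Λ_j`, at distance more than `D` from the boundary of `Λ_j`. (The distance
of a point `y` of the cube to the boundary is the least of the numbers `j - |y_k|`.) -/
def FarFromBoundary (R : Rectangle) (j : ℕ) (D : ℕ) : Prop :=
  ∀ s ≤ R.L, ∀ t ≤ R.H, ∀ k, (D : ℤ) < (j : ℤ) - |R.point s t k|

/-- With free boundary condition any rectangle in `Λ_j` is allowed; with zero boundary condition
the rectangle may not touch the boundary, where `θ` is frozen. -/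
def Allowed (R : Rectangle) (j : ℕ) : BoundaryCondition → Prop
  | .free => R.InBox j
  | .zero => R.FarFromBoundary j 0

/-- The aspect-ratio condition `L^{3/4} ≤ H ≤ L^{4/3}`. -/
def SufficientlySquare (R : Rectangle) : Prop :=
  (R.L : ℝ) ^ (3 / 4 : ℝ) ≤ (R.H : ℝ) ∧ (R.H : ℝ) ≤ (R.L : ℝ) ^ (4 / 3 : ℝ)

end Rectangle

/-- The probability that the simple random walk on `ℤ⁴` started at `0` is at `x` at time `n`. -/
noncomputable def srwProb : ℕ → Site → ℝ≥0∞
  | 0, x => if x = 0 then 1 else 0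
  | n + 1, x => (∑ i, (srwProb n (x + unit i) + srwProb n (x - unit i))) / 8

/-- The Green's function of `ℤ⁴`: the expected number of visits at `y` of the simple random walk
started at `x`, divided by the degree `8`. -/
noncomputable def green (x y : Site) : ℝ≥0∞ := (∑' n, srwProb n (y - x)) / 8

/-- `C_GFF = ∑_{k ∈ ℤ} G(0, k e_1)`, as an extended nonnegative number. -/
noncomputable def cGFF : ℝ≥0∞ := ∑' k : ℤ, green 0 (k • unit 0)

end VillainU1

namespace VillainU1

section ContourShift

open Complex

/-- Lebesgue measure on `[-π, π)`. -/
noncomputable abbrev circleMeasure : Measure ℝ :=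
  (volume : Measure ℝ).restrict (Set.Ico (-Real.pi) Real.pi)

lemma integral_circleMeasure (f : ℝ → ℂ) :
    ∫ x, f x ∂circleMeasure = ∫ x in (-Real.pi)..Real.pi, f x := by
  rw [intervalIntegral.integral_of_le (by linarith [Real.pi_pos]), integral_Ico_eq_integral_Ioo,
    integral_Ioc_eq_integral_Ioo]

/-- The integral of an entire `2π`-periodic function over a period does not change when the
contour is shifted in the imaginary direction. -/
lemma integral_periodic_shift {f : ℂ → ℂ} (hf : Differentiable ℂ f)
    (hper : ∀ z, f (z + 2 * Real.pi) = f z) (y : ℝ) :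
    ∫ x, f (x + y * I) ∂circleMeasure = ∫ x : ℝ, f x ∂circleMeasure := by
  have h := integral_boundary_rect_eq_zero_of_differentiableOn f (-Real.pi : ℂ)
    (Real.pi + y * I) hf.differentiableOn
  have h2 : ∀ t : ℝ, f (Real.pi + t * I) = f (-Real.pi + t * I) := by
    intro t
    rw [← hper (-Real.pi + t * I)]
    congr 1
    ring
  simp only [neg_re, ofReal_re, add_re, mul_re, I_re, mul_zero, ofReal_im, I_im, mul_one,
    sub_self, add_zero, neg_im, neg_zero, ofReal_zero, zero_mul, add_im, mul_im, zero_add,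
    ofReal_neg, h2] at h
  rw [integral_circleMeasure, integral_circleMeasure]
  linear_combination -h

/-- Entire functions of several variables, in the sense needed for shifting contours. -/
structure IsPeriodicEntire {ι : Type*} [DecidableEq ι] (F : (ι → ℂ) → ℂ) : Prop where
  continuous : Continuous F
  differentiable : ∀ z e, Differentiable ℂ fun w => F (Function.update z e w)
  periodic : ∀ z e, F (Function.update z e (z e + 2 * Real.pi)) = F z

lemma integrable_pi_circleMeasure {ι E : Type*} [Fintype ι] [NormedAddCommGroup E]
    {g : (ι → ℝ) → E} [SecondCountableTopologyEither (ι → ℝ) E] (hg : Continuous g) :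
    Integrable g (Measure.pi fun _ : ι => circleMeasure) := by
  have h1 : (Measure.pi fun _ : ι => circleMeasure) =
      (volume : Measure (ι → ℝ)).restrict (Set.univ.pi fun _ => Set.Ico (-Real.pi) Real.pi) :=
    (Measure.restrict_pi_pi _ _).symm
  rw [h1]
  have h2 : IsCompact (Set.univ.pi fun _ : ι => Set.Icc (-Real.pi) Real.pi) :=
    isCompact_univ_pi fun _ => isCompact_Icc
  exact (hg.continuousOn.integrableOn_compact h2).mono_set
    (Set.pi_mono fun _ _ => Set.Ico_subset_Icc_self)

lemma integral_shift_fin : ∀ (n : ℕ) (F : (Fin n → ℂ) → ℂ), IsPeriodicEntire F →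
    ∀ a : Fin n → ℝ,
      ∫ θ : Fin n → ℝ, F (fun e => θ e + a e * I) ∂(Measure.pi fun _ => circleMeasure) =
      ∫ θ : Fin n → ℝ, F (fun e => θ e) ∂(Measure.pi fun _ => circleMeasure)
  | 0, F, _, a => by
    congr 1
    ext θ
    congr 1
    exact Subsingleton.elim _ _
  | n + 1, F, hF, a => by
    have key : ∀ b : Fin (n + 1) → ℝ,
        ∫ θ : Fin (n + 1) → ℝ, F (fun e => θ e + b e * I) ∂(Measure.pi fun _ => circleMeasure) =
        ∫ x : ℝ, ∫ θ : Fin n → ℝ, F (Fin.cons (x + b 0 * I) fun e => θ e + b e.succ * I)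
          ∂(Measure.pi fun _ => circleMeasure) ∂circleMeasure ∧
        Integrable (fun p : ℝ × (Fin n → ℝ) =>
          F (Fin.cons (p.1 + b 0 * I) fun e => p.2 e + b e.succ * I))
          (circleMeasure.prod (Measure.pi fun _ => circleMeasure)) := by
      intro b
      have hmp := (measurePreserving_piFinSuccAbove
        (fun _ : Fin (n + 1) => circleMeasure) 0).symm
      have hco : ∀ p : ℝ × (Fin n → ℝ),
          (fun e => (((MeasurableEquiv.piFinSuccAbove (fun _ : Fin (n + 1) => ℝ) 0).symm p e : ℝ) : ℂ)
            + b e * I) = Fin.cons (p.1 + b 0 * I : ℂ) fun e => p.2 e + b e.succ * I := by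
        intro p
        ext e
        refine Fin.cases ?_ (fun i => ?_) e
        · simp [MeasurableEquiv.piFinSuccAbove, Fin.insertNthEquiv]
        · simp [MeasurableEquiv.piFinSuccAbove, Fin.insertNthEquiv]
      have hcont : Continuous fun θ : Fin (n + 1) → ℝ => F (fun e => θ e + b e * I) :=
        hF.continuous.comp (by fun_prop)
      have hint : Integrable (fun p : ℝ × (Fin n → ℝ) =>
          F (Fin.cons (p.1 + b 0 * I) fun e => p.2 e + b e.succ * I))
          (circleMeasure.prod (Measure.pi fun _ => circleMeasure)) := by
        have := (hmp.integrable_comp_emb (MeasurableEquiv.measurableEmbedding _)).2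
          (integrable_pi_circleMeasure hcont)
        refine this.congr (Eventually.of_forall fun p => ?_)
        simp only [Function.comp]
        rw [hco]
      refine ⟨?_, hint⟩
      rw [← hmp.integral_comp (MeasurableEquiv.measurableEmbedding _)]
      simp_rw [hco]
      exact integral_prod _ hint
    have hupd0 : ∀ (z w : ℂ) (u : Fin n → ℂ),
        (Fin.cons w u : Fin (n + 1) → ℂ) = Function.update (Fin.cons z u : Fin (n + 1) → ℂ) 0 w := by
      intro z w u
      simp
    have hupds : ∀ (z : ℂ) (u : Fin n → ℂ) (e : Fin n) (w : ℂ),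
        (Fin.cons z (Function.update u e w) : Fin (n + 1) → ℂ) =
          Function.update (Fin.cons z u : Fin (n + 1) → ℂ) e.succ w := by
      intro z u e w
      simp [Fin.cons_update]
    have hcons : ∀ z : ℂ, IsPeriodicEntire fun u : Fin n → ℂ => F (Fin.cons z u) := by
      intro z
      refine ⟨hF.continuous.comp ?_, fun u e => ?_, fun u e => ?_⟩
      · exact Continuous.finCons continuous_const continuous_id
      · simp_rw [hupds]
        exact hF.differentiable _ _
      · rw [hupds]
        have := hF.periodic (Fin.cons z u) e.succ
        simpa using this
    have k1 := (key a).1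
    obtain ⟨k2, k3⟩ := key (fun e => if e = 0 then a 0 else 0)
    obtain ⟨k4, k5⟩ := key 0
    simp only [if_true, Fin.succ_ne_zero, if_false, ofReal_zero, zero_mul, add_zero] at k2 k3
    simp only [Pi.zero_apply, ofReal_zero, zero_mul, add_zero] at k4 k5
    rw [k1, k4]
    have hinner : ∀ x : ℝ, ∫ θ : Fin n → ℝ, F (Fin.cons (x + a 0 * I) fun e => θ e + a e.succ * I)
          ∂(Measure.pi fun _ => circleMeasure) =
        ∫ θ : Fin n → ℝ, F (Fin.cons (x + a 0 * I) fun e => θ e)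
          ∂(Measure.pi fun _ => circleMeasure) := fun x =>
      integral_shift_fin n _ (hcons _) fun e => a e.succ
    simp_rw [hinner]
    refine (integral_integral_swap k3).trans (Eq.trans ?_ (integral_integral_swap k5).symm)
    congr 1
    ext θ
    refine integral_periodic_shift (f := fun z => F (Fin.cons z fun e => θ e)) ?_ ?_ (a 0)
    · have := hF.differentiable (Fin.cons 0 fun e => (θ e : ℂ)) 0
      simpa only [← hupd0] using this
    · intro z
      have := hF.periodic (Fin.cons z fun e => (θ e : ℂ)) 0
      simpa using this

/-- Contour shift for an entire function of several variables, `2π`-periodic in each of them. -/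
lemma integral_shift {ι : Type*} [Fintype ι] [DecidableEq ι] (F : (ι → ℂ) → ℂ)
    (hF : IsPeriodicEntire F) (a : ι → ℝ) :
    ∫ θ : ι → ℝ, F (fun e => θ e + a e * I) ∂(Measure.pi fun _ => circleMeasure) =
      ∫ θ : ι → ℝ, F (fun e => θ e) ∂(Measure.pi fun _ => circleMeasure) := by
  let σ := Fintype.equivFin ι
  have hmp := measurePreserving_piCongrLeft (fun _ : ι => circleMeasure) σ.symm
  rw [← hmp.integral_comp (MeasurableEquiv.measurableEmbedding _),
    ← hmp.integral_comp (MeasurableEquiv.measurableEmbedding _)]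
  have hco : ∀ (θ : Fin (Fintype.card ι) → ℝ) (e : ι),
      (MeasurableEquiv.piCongrLeft (fun _ : ι => ℝ) σ.symm) θ e = θ (σ e) := by
    intro θ e
    obtain ⟨i, rfl⟩ := σ.symm.surjective e
    rw [MeasurableEquiv.piCongrLeft_apply_apply]
    simp
  simp_rw [hco]
  have hupd : ∀ (u : Fin (Fintype.card ι) → ℂ) (i) (w : ℂ),
      (fun e => Function.update u i w (σ e)) =
        Function.update (fun e => u (σ e)) (σ.symm i) w := by
    intro u i w
    ext e
    by_cases h : σ e = i
    · subst h; simp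
    · have : e ≠ σ.symm i := fun h' => h (by simp [h'])
      simp [Function.update_of_ne h, Function.update_of_ne this]
  have hG : IsPeriodicEntire fun u : Fin (Fintype.card ι) → ℂ => F fun e => u (σ e) := by
    refine ⟨hF.continuous.comp (by fun_prop), fun u i => ?_, fun u i => ?_⟩
    · simp_rw [hupd]
      exact hF.differentiable _ _
    · rw [hupd]
      have := hF.periodic (fun e => u (σ e)) (σ.symm i)
      simpa using this
  have := integral_shift_fin _ _ hG fun i => a (σ.symm i)
  simpa using this

end ContourShift

section VillainFunction

open Complex

/-- The Villain weight of a single plaquette, as an entire function of the angle. -/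
noncomputable def villainFun (β : ℝ) (z : ℂ) : ℂ :=
  ∑' m : ℤ, cexp (-(β / 2) * (2 * Real.pi * (m : ℂ) + z) ^ 2)

/-- The Villain weight of a single plaquette. -/
noncomputable def villainReal (β : ℝ) (x : ℝ) : ℝ :=
  ∑' m : ℤ, Real.exp (-(β / 2) * (2 * Real.pi * (m : ℝ) + x) ^ 2)

lemma villainFun_term (β : ℝ) (m : ℤ) (z : ℂ) :
    cexp (-(β / 2) * (2 * Real.pi * (m : ℂ) + z) ^ 2) =
      cexp (-(β / 2) * z ^ 2) * jacobiTheta₂_term m (I * β * z) (2 * Real.pi * β * I) := by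
  rw [jacobiTheta₂_term, ← Complex.exp_add]
  congr 1
  linear_combination (-2 * (Real.pi : ℂ) * β * m * z - 2 * Real.pi ^ 2 * β * m ^ 2) * I_sq

lemma im_tau_pos {β : ℝ} (hβ : 0 < β) : 0 < (2 * Real.pi * β * I : ℂ).im := by
  have := Real.pi_pos
  have h : (2 * Real.pi * β * I : ℂ) = ((2 * Real.pi * β : ℝ) : ℂ) * I := by push_cast; ring
  rw [h, im_ofReal_mul, I_im, mul_one]
  positivity

lemma summable_villainFun {β : ℝ} (hβ : 0 < β) (z : ℂ) :
    Summable fun m : ℤ => cexp (-(β / 2) * (2 * Real.pi * (m : ℂ) + z) ^ 2) := by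
  simp_rw [villainFun_term]
  exact ((summable_jacobiTheta₂_term_iff _ _).2 (im_tau_pos hβ)).mul_left _

lemma villainFun_ofReal (β x : ℝ) : villainFun β x = villainReal β x := by
  rw [villainFun, villainReal, ofReal_tsum]
  push_cast
  rfl

lemma villainReal_nonneg (β x : ℝ) : 0 ≤ villainReal β x :=
  tsum_nonneg fun _ => Real.exp_nonneg _

lemma differentiable_villainFun {β : ℝ} (hβ : 0 < β) : Differentiable ℂ (villainFun β) := by
  have h : villainFun β = fun z => cexp (-(β / 2) * z ^ 2) *
      jacobiTheta₂ (I * β * z) (2 * Real.pi * β * I) := by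
    ext z
    simp_rw [villainFun, villainFun_term, tsum_mul_left, jacobiTheta₂]
  rw [h]
  have h2 : Differentiable ℂ fun z : ℂ => jacobiTheta₂ (I * β * z) (2 * Real.pi * β * I) := by
    intro z
    exact (differentiableAt_jacobiTheta₂_fst (I * β * z) (im_tau_pos hβ)).comp z
      (f := fun z => I * β * z) (by fun_prop)
  exact Differentiable.mul (by fun_prop) h2

lemma villainFun_add_int (β : ℝ) (z : ℂ) (k : ℤ) :
    villainFun β (z + k * (2 * Real.pi)) = villainFun β z := by
  rw [villainFun, villainFun,
    ← (Equiv.addRight k).tsum_eq fun m : ℤ => cexp (-(β / 2) * (2 * Real.pi * (m : ℂ) + z) ^ 2)]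
  refine tsum_congr fun m => ?_
  simp only [Equiv.coe_addRight]
  push_cast
  congr 2
  ring

lemma continuous_villainReal {β : ℝ} (hβ : 0 < β) : Continuous (villainReal β) := by
  have h : villainReal β = fun x : ℝ => (villainFun β x).re := by
    ext x
    rw [villainFun_ofReal, ofReal_re]
  rw [h]
  exact continuous_re.comp ((differentiable_villainFun hβ).continuous.comp continuous_ofReal)

lemma norm_villainFun_le {β : ℝ} (hβ : 0 < β) (x y : ℝ) :
    ‖villainFun β (x + y * I)‖ ≤ Real.exp (β / 2 * y ^ 2) * villainReal β x := by
  rw [villainFun, villainReal, ← tsum_mul_left]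
  refine (norm_tsum_le_tsum_norm (summable_villainFun hβ _).norm).trans (le_of_eq ?_)
  refine tsum_congr fun m => ?_
  rw [norm_exp, ← Real.exp_add]
  congr 1
  have : (-((β : ℂ) / 2) * (2 * Real.pi * (m : ℂ) + (x + y * I)) ^ 2) =
      ((-(β / 2) * (2 * Real.pi * m + x) ^ 2 + β / 2 * y ^ 2 : ℝ) : ℂ) +
        ((-β * (2 * Real.pi * m + x) * y : ℝ) : ℂ) * I := by
    push_cast
    linear_combination (-(β : ℂ) / 2 * y ^ 2) * I_sq
  rw [this, add_re, ofReal_re, re_ofReal_mul, I_re]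
  ring

variable {ι κ : Type*} [Fintype ι]

/-- The complexified integrand of a charged Villain integral. -/
noncomputable def chargedIntegrand (β : ℝ) (A : Finset κ) (c : ι → ℤ) (n : κ → ι → ℤ) (z : ι → ℂ) :
    ℂ :=
  cexp (I * ∑ e, c e * z e) * ∏ f ∈ A, villainFun β (∑ e, n f e * z e)

lemma isPeriodicEntire_chargedIntegrand [DecidableEq ι] {β : ℝ} (hβ : 0 < β) (A : Finset κ)
    (c : ι → ℤ) (n : κ → ι → ℤ) : IsPeriodicEntire (chargedIntegrand β A c n) := by
  have hd := differentiable_villainFun hβ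
  have hlin : ∀ (m : ι → ℤ) (z : ι → ℂ) (e : ι) (w : ℂ),
      ∑ e', (m e' : ℂ) * Function.update z e w e' = ∑ e', (m e' : ℂ) * z e' + m e * (w - z e) := by
    intro m z e w
    rw [← sub_eq_iff_eq_add', ← Finset.sum_sub_distrib, Finset.sum_eq_single e]
    · simp; ring
    · intro b _ hb
      simp [Function.update_of_ne hb]
    · simp
  refine ⟨?_, fun z e => ?_, fun z e => ?_⟩
  · unfold chargedIntegrand
    refine Continuous.mul (by fun_prop) (continuous_finsetProd _ fun f _ => ?_)
    exact hd.continuous.comp (by fun_prop)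
  · simp only [chargedIntegrand, hlin]
    refine Differentiable.mul (by fun_prop) ?_
    refine Differentiable.fun_finsetProd fun f _ => ?_
    exact hd.comp (by fun_prop)
  · simp only [chargedIntegrand, hlin, add_sub_cancel_left]
    congr 1
    · have : I * ((c e : ℂ) * (2 * Real.pi)) = c e * (2 * Real.pi * I) := by ring
      rw [mul_add, Complex.exp_add, this, exp_int_mul_two_pi_mul_I, mul_one]
    · simp_rw [villainFun_add_int]

/-- The McBryan–Spencer bound: shifting the contour of integration by `i a`. -/
theorem norm_integral_charged_le {β : ℝ} (hβ : 0 < β) (A : Finset κ)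
    (c : ι → ℤ) (n : κ → ι → ℤ) (a : ι → ℝ) :
    ‖∫ θ : ι → ℝ, cexp (I * ∑ e, c e * θ e) * (∏ f ∈ A, villainReal β (∑ e, n f e * θ e) : ℝ)
      ∂(Measure.pi fun _ => circleMeasure)‖ ≤
    Real.exp (-(∑ e, c e * a e - β / 2 * ∑ f ∈ A, (∑ e, n f e * a e) ^ 2)) *
      ∫ θ : ι → ℝ, ∏ f ∈ A, villainReal β (∑ e, n f e * θ e)
        ∂(Measure.pi fun _ => circleMeasure) := by
  classical
  have h := integral_shift _ (isPeriodicEntire_chargedIntegrand hβ A c n) a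
  have h1 : ∀ θ : ι → ℝ, chargedIntegrand β A c n (fun e => θ e) =
      cexp (I * ∑ e, c e * θ e) * (∏ f ∈ A, villainReal β (∑ e, n f e * θ e) : ℝ) := by
    intro θ
    rw [chargedIntegrand]
    congr 1
    · push_cast
      rfl
    · rw [ofReal_prod]
      refine Finset.prod_congr rfl fun f _ => ?_
      rw [← villainFun_ofReal]
      push_cast
      rfl
  simp_rw [← h1]
  rw [← h, ← integral_const_mul]
  refine norm_integral_le_of_norm_le ?_ (Eventually.of_forall fun θ => ?_)
  · refine Integrable.const_mul (integrable_pi_circleMeasure ?_) _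
    exact continuous_finsetProd _ fun f _ => (continuous_villainReal hβ).comp (by fun_prop)
  · have hs : ∀ m : ι → ℤ, ∑ e, (m e : ℂ) * (θ e + a e * I) =
        ((∑ e, m e * θ e : ℝ) : ℂ) + ((∑ e, m e * a e : ℝ) : ℂ) * I := by
      intro m
      push_cast
      rw [Finset.sum_mul, ← Finset.sum_add_distrib]
      exact Finset.sum_congr rfl fun e _ => by ring
    rw [chargedIntegrand, norm_mul, norm_prod, norm_exp]
    simp_rw [hs]
    have hre : (I * (((∑ e, c e * θ e : ℝ) : ℂ) + ((∑ e, c e * a e : ℝ) : ℂ) * I)).re =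
        -∑ e, c e * a e := by
      rw [mul_add, add_re, I_mul_re, ofReal_im, ← mul_assoc, mul_comm I, mul_assoc, I_mul_I,
        mul_neg, mul_one, neg_re, ofReal_re, neg_zero, zero_add]
    rw [hre, neg_sub, sub_eq_neg_add, Real.exp_add, mul_assoc]
    refine mul_le_mul_of_nonneg_left ?_ (Real.exp_nonneg _)
    rw [Finset.mul_sum, Real.exp_sum, ← Finset.prod_mul_distrib]
    exact Finset.prod_le_prod (fun _ _ => norm_nonneg _) fun f _ => norm_villainFun_le hβ _ _

end VillainFunction

/-- The oriented sum of a `1`-form along the boundary loop of a rectangle. -/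
noncomputable def Rectangle.loopSum (R : Rectangle) (a : Edge → ℝ) : ℝ :=
  ∑ s ∈ Finset.range R.L, a (R.point s 0, R.a) + ∑ t ∈ Finset.range R.H, a (R.point R.L t, R.b) -
    ∑ s ∈ Finset.range R.L, a (R.point s R.H, R.a) - ∑ t ∈ Finset.range R.H, a (R.point 0 t, R.b)

lemma Rectangle.wilson_eq_exp (R : Rectangle) (θ : Edge → ℝ) :
    R.wilson θ = Complex.exp (Complex.I * R.loopSum θ) := by
  simp only [Rectangle.wilson, Rectangle.loopSum, ← Complex.exp_sum, ← Complex.exp_add]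
  congr 1
  push_cast
  simp only [Finset.sum_neg_distrib, ← Finset.mul_sum]
  ring

/-- Linear forms with integer coefficients in the variables indexed by `S`. -/
def IsIntegralForm (S : Finset Edge) (l : (Edge → ℝ) → ℝ) : Prop :=
  ∃ c : S → ℤ, ∀ θ : S → ℝ, l (extendByZero S θ) = ∑ e, c e * θ e

namespace IsIntegralForm

variable {S : Finset Edge} {l l' : (Edge → ℝ) → ℝ}

lemma eval (S : Finset Edge) (e : Edge) : IsIntegralForm S fun θ => θ e := by
  refine ⟨fun e' => if (e' : Edge) = e then 1 else 0, fun θ => ?_⟩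
  change (if h : e ∈ S then θ ⟨e, h⟩ else 0) = _
  split_ifs with h
  · rw [Finset.sum_eq_single ⟨e, h⟩] <;> simp +contextual [Subtype.ext_iff]
  · rw [Finset.sum_eq_zero]
    intro e' _
    have : (e' : Edge) ≠ e := fun h' => h (h' ▸ e'.2)
    simp [this]

lemma add (h : IsIntegralForm S l) (h' : IsIntegralForm S l') :
    IsIntegralForm S fun θ => l θ + l' θ := by
  obtain ⟨c, hc⟩ := h
  obtain ⟨c', hc'⟩ := h'
  refine ⟨c + c', fun θ => ?_⟩
  simp [hc, hc', add_mul, Finset.sum_add_distrib]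

lemma sub (h : IsIntegralForm S l) (h' : IsIntegralForm S l') :
    IsIntegralForm S fun θ => l θ - l' θ := by
  obtain ⟨c, hc⟩ := h
  obtain ⟨c', hc'⟩ := h'
  refine ⟨c - c', fun θ => ?_⟩
  simp [hc, hc', sub_mul, Finset.sum_sub_distrib]

lemma sum {κ : Type*} (s : Finset κ) {l : κ → (Edge → ℝ) → ℝ}
    (h : ∀ k, IsIntegralForm S (l k)) : IsIntegralForm S fun θ => ∑ k ∈ s, l k θ := by
  choose c hc using h
  refine ⟨fun e => ∑ k ∈ s, c k e, fun θ => ?_⟩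
  simp only [hc]
  rw [Finset.sum_comm]
  push_cast
  simp only [Finset.sum_mul]

lemma loopSum (S : Finset Edge) (R : Rectangle) : IsIntegralForm S R.loopSum :=
  (((sum _ fun _ => eval S _).add (sum _ fun _ => eval S _)).sub (sum _ fun _ => eval S _)).sub
    (sum _ fun _ => eval S _)

lemma dOne (S : Finset Edge) (f : Plaquette) : IsIntegralForm S fun θ => dOne θ f :=
  (((eval S _).add (eval S _)).sub (eval S _)).sub (eval S _)

end IsIntegralForm

lemma measurable_extendByZero (S : Finset Edge) : Measurable (extendByZero S) := by
  refine measurable_pi_lambda _ fun e => ?_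
  unfold extendByZero
  split_ifs with h
  · exact measurable_pi_apply _
  · exact measurable_const

lemma continuous_dOne (f : Plaquette) : Continuous fun θ : Edge → ℝ => dOne θ f := by
  unfold dOne
  fun_prop

lemma Rectangle.continuous_loopSum (R : Rectangle) : Continuous R.loopSum := by
  unfold Rectangle.loopSum
  fun_prop

lemma Rectangle.continuous_wilson (R : Rectangle) : Continuous R.wilson := by
  simp_rw [funext R.wilson_eq_exp]
  have := R.continuous_loopSum
  fun_prop

lemma continuous_villainWeight {β : ℝ} (hβ : 0 < β) (bc : BoundaryCondition) (j : ℕ) :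
    Continuous (villainWeight β bc j) :=
  continuous_finsetProd _ fun f _ => (continuous_villainReal hβ).comp (continuous_dOne f)

lemma villainWeight_nonneg (β : ℝ) (bc : BoundaryCondition) (j : ℕ) (θ : Edge → ℝ) :
    0 ≤ villainWeight β bc j θ :=
  Finset.prod_nonneg fun _ _ => villainReal_nonneg _ _

/-- Spin-wave bound: every `1`-form `a` vanishing on the frozen edges yields an upper bound for
the Wilson loop expectation. -/
theorem norm_integral_wilson_le {β : ℝ} (hβ : 0 < β) (bc : BoundaryCondition) (j : ℕ)
    (R : Rectangle) (a : Edge → ℝ) (ha : ∀ e ∉ activeEdges j bc, a e = 0) :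
    ‖∫ θ, R.wilson θ ∂(villain β bc j)‖ ≤
      Real.exp (-(R.loopSum a - β / 2 * ∑ f ∈ activePlaquettes j bc, dOne a f ^ 2)) := by
  set S := activeEdges j bc
  obtain ⟨c, hc⟩ := IsIntegralForm.loopSum S R
  choose n hn using IsIntegralForm.dOne S
  have hae : extendByZero S (fun e => a e) = a := by
    ext e
    unfold extendByZero
    split_ifs with h
    · rfl
    · exact (ha e h).symm
  have hw := continuous_villainWeight hβ bc j
  have key := norm_integral_charged_le hβ (activePlaquettes j bc) c n fun e : S => a e
  have hI1 : ∫ θ, R.wilson θ ∂(villainUnnormalised β bc j) =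
      ∫ θ : S → ℝ, Complex.exp (Complex.I * ∑ e, c e * θ e) *
        (∏ f ∈ activePlaquettes j bc, villainReal β (∑ e, n f e * θ e) : ℝ)
      ∂(Measure.pi fun _ => circleMeasure) := by
    rw [villainUnnormalised, integral_withDensity_eq_integral_toReal_smul
      hw.measurable.ennreal_ofReal (Eventually.of_forall fun _ => ENNReal.ofReal_lt_top),
      angleMeasure, integral_map (measurable_extendByZero S).aemeasurable]
    · congr 1
      ext θ
      rw [ENNReal.toReal_ofReal (villainWeight_nonneg _ _ _ _), R.wilson_eq_exp, hc,
        Complex.real_smul, mul_comm]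
      congr 2
      exact Finset.prod_congr rfl fun f _ => by rw [← hn]; rfl
    · refine Measurable.aestronglyMeasurable ?_
      exact hw.measurable.ennreal_ofReal.ennreal_toReal.smul R.continuous_wilson.measurable
  have hI2 : (villainUnnormalised β bc j Set.univ).toReal =
      ∫ θ : S → ℝ, ∏ f ∈ activePlaquettes j bc, villainReal β (∑ e, n f e * θ e)
        ∂(Measure.pi fun _ => circleMeasure) := by
    rw [villainUnnormalised, withDensity_apply _ MeasurableSet.univ, Measure.restrict_univ,
      angleMeasure, lintegral_map hw.measurable.ennreal_ofReal (measurable_extendByZero S),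
      ← integral_eq_lintegral_of_nonneg_ae (f := fun θ => villainWeight β bc j (extendByZero S θ))]
    · congr 1
      ext θ
      exact Finset.prod_congr rfl fun f _ => by rw [← hn]; rfl
    · exact Eventually.of_forall fun θ => villainWeight_nonneg _ _ _ _
    · exact (hw.measurable.comp (measurable_extendByZero S)).aestronglyMeasurable
  rw [← hI1, ← hI2] at key
  rw [villain, integral_smul_measure, norm_smul, Real.norm_of_nonneg ENNReal.toReal_nonneg,
    ENNReal.toReal_inv]
  simp only [← hc, ← hn, hae] at key
  refine (mul_le_mul_of_nonneg_left key (by positivity)).trans ?_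
  rw [← mul_assoc, mul_comm, ← mul_assoc]
  refine mul_le_of_le_one_left (Real.exp_nonneg _) ?_
  exact mul_inv_le_one

/-- A uniform bound in finite volume is inherited by infinite-volume limits. -/
lemma norm_integral_wilson_le_of_eventually {β : ℝ} {bc : BoundaryCondition}
    {P : Measure (Edge → ℝ)} (hP : IsInfiniteVolumeVillain β bc P) (R : Rectangle) {B : ℝ}
    (hB : ∀ᶠ j in atTop, ‖∫ θ, R.wilson θ ∂(villain β bc j)‖ ≤ B) :
    ‖∫ θ, R.wilson θ ∂P‖ ≤ B := by
  obtain ⟨hP1, φ, hφ, hlim⟩ := hP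
  have hfin : ∀ j, IsFiniteMeasure (villain β bc j) := by
    refine fun j => ⟨lt_of_le_of_lt ?_ ENNReal.one_lt_top⟩
    exact ENNReal.inv_mul_le_one _
  have hre := R.continuous_wilson
  have hb : ∀ θ, ‖R.wilson θ‖ ≤ 1 := by
    intro θ
    rw [R.wilson_eq_exp, mul_comm, Complex.norm_exp_ofReal_mul_I]
  have hint : ∀ (Q : Measure (Edge → ℝ)) [IsFiniteMeasure Q], Integrable R.wilson Q := fun Q _ =>
    Integrable.of_bound hre.aestronglyMeasurable 1 (Eventually.of_forall hb)
  let F : (Edge → ℝ) →ᵇ ℝ := BoundedContinuousFunction.ofNormedAddCommGroup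
    (fun θ => (R.wilson θ).re) (Complex.continuous_re.comp hre) 1
    fun θ => (Complex.abs_re_le_norm _).trans (hb θ)
  let G : (Edge → ℝ) →ᵇ ℝ := BoundedContinuousFunction.ofNormedAddCommGroup
    (fun θ => (R.wilson θ).im) (Complex.continuous_im.comp hre) 1
    fun θ => (Complex.abs_im_le_norm _).trans (hb θ)
  have hdec : ∀ (Q : Measure (Edge → ℝ)) [IsFiniteMeasure Q],
      ∫ θ, R.wilson θ ∂Q = ((∫ θ, F θ ∂Q : ℝ) : ℂ) + ((∫ θ, G θ ∂Q : ℝ) : ℂ) * Complex.I := by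
    intro Q _
    exact (integral_re_add_im (𝕜 := ℂ) (hint Q)).symm
  have hlim2 : Tendsto (fun n => ∫ θ, R.wilson θ ∂(villain β bc (φ n))) atTop
      (𝓝 (∫ θ, R.wilson θ ∂P)) := by
    rw [hdec P]
    simp_rw [hdec]
    exact ((Complex.continuous_ofReal.tendsto _).comp (hlim F)).add
      (((Complex.continuous_ofReal.tendsto _).comp (hlim G)).mul_const _)
  exact le_of_tendsto hlim2.norm (hφ.tendsto_atTop.eventually hB)

section RandomWalk

@[simp] lemma unit_apply_self (i : Fin 4) : unit i i = 1 := by simp [unit]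

lemma unit_apply_of_ne {i k : Fin 4} (h : k ≠ i) : unit i k = 0 := by simp [unit, h]

lemma srwProb_ne_top (n : ℕ) (x : Site) : srwProb n x ≠ ∞ := by
  induction n generalizing x with
  | zero => unfold srwProb; split_ifs <;> simp
  | succ n ih =>
    unfold srwProb
    refine ENNReal.div_ne_top ?_ (by norm_num)
    exact ENNReal.sum_ne_top.2 fun i _ => ENNReal.add_ne_top.2 ⟨ih _, ih _⟩

lemma srwProb_eq_zero {n : ℕ} {x : Site} {i : Fin 4} (h : (n : ℤ) < |x i|) : srwProb n x = 0 := by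
  induction n generalizing x with
  | zero =>
    unfold srwProb
    rw [if_neg]
    rintro rfl
    simp at h
  | succ n ih =>
    unfold srwProb
    rw [ENNReal.div_eq_zero_iff]
    left
    have hu : ∀ k : Fin 4, |unit k i| ≤ 1 := by
      intro k
      by_cases hk : i = k
      · subst hk; simp
      · simp [unit_apply_of_ne hk]
    push_cast at h
    refine Finset.sum_eq_zero fun k _ => ?_
    rw [ih, ih, add_zero]
    · have := abs_sub_abs_le_abs_sub (x i) (unit k i)
      have := hu k
      simp only [Pi.sub_apply]
      linarith
    · have h2 := abs_sub_abs_le_abs_sub (x i) (-unit k i)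
      have := hu k
      rw [abs_neg, sub_neg_eq_add] at h2
      simp only [Pi.add_apply]
      linarith

/-- The probability that the simple random walk is at time `n` on the line through `y` in
direction `e_a`. -/
noncomputable def lineProb (n : ℕ) (a : Fin 4) (y : Site) : ℝ≥0∞ :=
  ∑' k : ℤ, srwProb n (y + k • unit a)

lemma lineProb_succ (n : ℕ) (a : Fin 4) (y : Site) :
    lineProb (n + 1) a y = (∑ i, (lineProb n a (y + unit i) + lineProb n a (y - unit i))) / 8 := by
  simp only [lineProb, srwProb, div_eq_mul_inv, ENNReal.tsum_mul_right]
  congr 1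
  rw [Summable.tsum_finsetSum fun _ _ => ENNReal.summable]
  refine Finset.sum_congr rfl fun i _ => ?_
  rw [ENNReal.tsum_add]
  congr 1 <;> exact tsum_congr fun k => by congr 1; abel

lemma lineProb_eq_zero {n : ℕ} {a i : Fin 4} (hia : i ≠ a) {y : Site} (h : (n : ℤ) < |y i|) :
    lineProb n a y = 0 := by
  rw [lineProb, ENNReal.tsum_eq_zero]
  intro k
  refine srwProb_eq_zero (i := i) ?_
  simpa [unit_apply_of_ne hia] using h

/-- The characteristic function of the projection to `ℤ³` of one step of the walk. -/
noncomputable def charFun3 (k : Fin 3 → ℝ) : ℝ := (1 + ∑ i, Real.cos (k i)) / 4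

/-- The Fourier integral for the transition probabilities of the walk projected to `ℤ³`. -/
noncomputable def fourier3 (n : ℕ) (w : Fin 3 → ℤ) : ℝ :=
  ((2 * Real.pi) ^ 3)⁻¹ * ∫ k : Fin 3 → ℝ, charFun3 k ^ n * ∏ i, Real.cos (k i * w i)
    ∂(Measure.pi fun _ => circleMeasure)

lemma integral_cos_mul_int (m : ℤ) :
    ∫ x, Real.cos (x * m) ∂circleMeasure = if m = 0 then 2 * Real.pi else 0 := by
  rw [integral_Ico_eq_integral_Ioo, ← integral_Ioc_eq_integral_Ioo,
    ← intervalIntegral.integral_of_le (by linarith [Real.pi_pos])]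
  split_ifs with h
  · subst h
    simp
    ring
  · have hm : (m : ℝ) ≠ 0 := by exact_mod_cast h
    rw [intervalIntegral.integral_comp_mul_right _ hm, integral_cos]
    have h1 : Real.sin (Real.pi * m) = 0 := by rw [mul_comm]; exact Real.sin_int_mul_pi m
    simp [h1]

lemma fourier3_zero (w : Fin 3 → ℤ) : fourier3 0 w = if w = 0 then 1 else 0 := by
  unfold fourier3
  simp only [pow_zero, one_mul]
  rw [integral_fintype_prod_eq_prod (fun i x => Real.cos (x * w i))]
  simp_rw [integral_cos_mul_int]
  split_ifs with h
  · subst h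
    have := Real.pi_pos
    simp only [Pi.zero_apply, if_true, Finset.prod_const, Finset.card_univ, Fintype.card_fin]
    exact inv_mul_cancel₀ (by positivity)
  · obtain ⟨i, hi⟩ := Function.ne_iff.1 h
    rw [Finset.prod_eq_zero (Finset.mem_univ i), mul_zero]
    rw [if_neg]
    exact hi

lemma integrable_fourier3 (n : ℕ) (w : Fin 3 → ℤ) :
    Integrable (fun k : Fin 3 → ℝ => charFun3 k ^ n * ∏ i, Real.cos (k i * w i))
      (Measure.pi fun _ => circleMeasure) := by
  refine integrable_pi_circleMeasure ?_
  unfold charFun3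
  fun_prop

lemma prod_cos_add_single (k : Fin 3 → ℝ) (w : Fin 3 → ℤ) (i : Fin 3) :
    ∏ l, Real.cos (k l * (w + Pi.single i 1 : Fin 3 → ℤ) l) +
      ∏ l, Real.cos (k l * (w - Pi.single i 1 : Fin 3 → ℤ) l) =
    2 * Real.cos (k i) * ∏ l, Real.cos (k l * w l) := by
  rw [← Finset.mul_prod_erase _ _ (Finset.mem_univ i), ← Finset.mul_prod_erase _ _
    (Finset.mem_univ i), ← Finset.mul_prod_erase _ _ (Finset.mem_univ i)]
  have h1 : ∏ l ∈ Finset.univ.erase i, Real.cos (k l * (w + Pi.single i 1 : Fin 3 → ℤ) l) =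
      ∏ l ∈ Finset.univ.erase i, Real.cos (k l * w l) :=
    Finset.prod_congr rfl fun l hl => by simp [Finset.ne_of_mem_erase hl]
  have h2 : ∏ l ∈ Finset.univ.erase i, Real.cos (k l * (w - Pi.single i 1 : Fin 3 → ℤ) l) =
      ∏ l ∈ Finset.univ.erase i, Real.cos (k l * w l) :=
    Finset.prod_congr rfl fun l hl => by simp [Finset.ne_of_mem_erase hl]
  rw [h1, h2]
  simp only [Pi.add_apply, Pi.sub_apply, Pi.single_eq_same]
  push_cast
  rw [mul_add, mul_sub, mul_one, Real.cos_add, Real.cos_sub]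
  ring

lemma fourier3_succ (n : ℕ) (w : Fin 3 → ℤ) :
    fourier3 (n + 1) w = (2 * fourier3 n w +
      ∑ i, (fourier3 n (w + Pi.single i 1) + fourier3 n (w - Pi.single i 1))) / 8 := by
  have hpt : ∀ k : Fin 3 → ℝ, charFun3 k ^ (n + 1) * ∏ i, Real.cos (k i * w i) =
      (1 / 8) * (2 * (charFun3 k ^ n * ∏ i, Real.cos (k i * w i)) +
        ∑ i, (charFun3 k ^ n * ∏ l, Real.cos (k l * (w + Pi.single i 1 : Fin 3 → ℤ) l) +
          charFun3 k ^ n * ∏ l, Real.cos (k l * (w - Pi.single i 1 : Fin 3 → ℤ) l))) := by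
    intro k
    simp_rw [← mul_add, prod_cos_add_single]
    rw [pow_succ]
    nth_rewrite 2 [charFun3]
    rw [← Finset.mul_sum, ← Finset.sum_mul, ← Finset.mul_sum]
    ring
  unfold fourier3
  simp_rw [hpt]
  rw [integral_const_mul, integral_add ((integrable_fourier3 n w).const_mul 2),
    integral_const_mul, integral_finsetSum]
  · simp_rw [integral_add (integrable_fourier3 n _) (integrable_fourier3 n _)]
    simp_rw [← mul_add]
    rw [← Finset.mul_sum]
    ring
  · exact fun i _ => (integrable_fourier3 n _).add (integrable_fourier3 n _)
  · exact integrable_finsetSum _ fun i _ => (integrable_fourier3 n _).add (integrable_fourier3 n _)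

lemma lineProb_eq_fourier3 (n : ℕ) (a : Fin 4) (y : Site) :
    0 ≤ fourier3 n (fun i => y (a.succAbove i)) ∧
      lineProb n a y = ENNReal.ofReal (fourier3 n fun i => y (a.succAbove i)) := by
  induction n generalizing y with
  | zero =>
    rw [fourier3_zero]
    split_ifs with h
    · refine ⟨zero_le_one, ?_⟩
      rw [lineProb, tsum_eq_single (-y a)]
      · simp only [srwProb]
        rw [if_pos, ENNReal.ofReal_one]
        ext i
        rcases eq_or_ne i a with rfl | hi
        · simp
        · obtain ⟨l, rfl⟩ := Fin.exists_succAbove_eq hi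
          have := congrFun h l
          simpa [unit_apply_of_ne hi] using this
      · intro k hk
        simp only [srwProb]
        rw [if_neg]
        intro h0
        have := congrFun h0 a
        simp at this
        omega
    · refine ⟨le_rfl, ?_⟩
      rw [lineProb, ENNReal.ofReal_zero, ENNReal.tsum_eq_zero]
      intro k
      simp only [srwProb]
      rw [if_neg]
      intro h0
      apply h
      ext l
      have := congrFun h0 (a.succAbove l)
      simpa [unit_apply_of_ne (Fin.succAbove_ne a l)] using this
  | succ n ih =>
    have hu : ∀ l : Fin 3, (fun i => unit (a.succAbove l) (a.succAbove i)) =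
        (Pi.single l 1 : Fin 3 → ℤ) := by
      intro l
      ext i
      simp [unit, Pi.single_apply]
    have hua : (fun i => unit a (a.succAbove i)) = 0 := by
      ext i
      exact unit_apply_of_ne (Fin.succAbove_ne a i)
    have hplus : ∀ l : Fin 3, (fun i => (y + unit (a.succAbove l)) (a.succAbove i)) =
        (fun i => y (a.succAbove i)) + Pi.single l 1 := by
      intro l
      rw [← hu]
      rfl
    have hminus : ∀ l : Fin 3, (fun i => (y - unit (a.succAbove l)) (a.succAbove i)) =
        (fun i => y (a.succAbove i)) - Pi.single l 1 := by
      intro l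
      rw [← hu]
      rfl
    have hplusa : (fun i => (y + unit a) (a.succAbove i)) = (fun i => y (a.succAbove i)) := by
      ext i
      simp [unit_apply_of_ne (Fin.succAbove_ne a i)]
    have hminusa : (fun i => (y - unit a) (a.succAbove i)) = (fun i => y (a.succAbove i)) := by
      ext i
      simp [unit_apply_of_ne (Fin.succAbove_ne a i)]
    have h0 := (ih y).1
    have hp : ∀ l : Fin 3, 0 ≤ fourier3 n ((fun i => y (a.succAbove i)) + Pi.single l 1) := by
      intro l
      rw [← hplus]
      exact (ih _).1
    have hm : ∀ l : Fin 3, 0 ≤ fourier3 n ((fun i => y (a.succAbove i)) - Pi.single l 1) := by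
      intro l
      rw [← hminus]
      exact (ih _).1
    have hs : 0 ≤ ∑ i, (fourier3 n ((fun i => y (a.succAbove i)) + Pi.single i 1) +
        fourier3 n ((fun i => y (a.succAbove i)) - Pi.single i 1)) :=
      Finset.sum_nonneg fun l _ => add_nonneg (hp l) (hm l)
    rw [fourier3_succ]
    have h2 := add_nonneg h0 h0
    rw [← two_mul] at h2
    refine ⟨div_nonneg (add_nonneg h2 hs) (by norm_num), ?_⟩
    have hsum : ∑ i, (lineProb n a (y + unit (a.succAbove i)) +
        lineProb n a (y - unit (a.succAbove i))) =
        ENNReal.ofReal (∑ i, (fourier3 n ((fun i => y (a.succAbove i)) + Pi.single i 1) +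
          fourier3 n ((fun i => y (a.succAbove i)) - Pi.single i 1))) := by
      rw [ENNReal.ofReal_sum_of_nonneg fun l _ => add_nonneg (hp l) (hm l)]
      refine Finset.sum_congr rfl fun l _ => ?_
      rw [ENNReal.ofReal_add (hp l) (hm l), (ih _).2, (ih _).2, hplus, hminus]
    rw [lineProb_succ, Fin.sum_univ_succAbove _ a, hsum, (ih (y + unit a)).2,
      (ih (y - unit a)).2, hplusa, hminusa, ENNReal.ofReal_div_of_pos (by norm_num),
      ENNReal.ofReal_add h2 hs, two_mul, ENNReal.ofReal_add h0 h0,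
      ENNReal.ofReal_ofNat]

lemma abs_charFun3_le (k : Fin 3 → ℝ) (hk : ∀ i, |k i| ≤ Real.pi) :
    |charFun3 k| ≤ Real.exp (-(6 * Real.pi ^ 2)⁻¹ * ∑ i, k i ^ 2) := by
  have hpi := Real.pi_pos
  have h1 := fun i => Real.cos_le_one_sub_mul_cos_sq (hk i)
  have h2 := fun i => Real.neg_one_le_cos (k i)
  have h3 : ∀ i, (6 * Real.pi ^ 2)⁻¹ * k i ^ 2 ≤ 1 / 6 := by
    intro i
    have := sq_le_sq' (by linarith [abs_le.1 (hk i)]) (abs_le.1 (hk i)).2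
    rw [inv_mul_le_iff₀ (by positivity)]
    linarith
  have h4 : ∀ i, 2 / Real.pi ^ 2 * k i ^ 2 = 12 * ((6 * Real.pi ^ 2)⁻¹ * k i ^ 2) := by
    intro i
    field_simp
    ring
  have h5 : ∀ i, 0 ≤ (6 * Real.pi ^ 2)⁻¹ * k i ^ 2 := fun i => by positivity
  refine le_trans ?_ (Real.add_one_le_exp _)
  simp only [h4] at h1
  unfold charFun3
  rw [neg_mul, Finset.mul_sum]
  simp only [Fin.sum_univ_three]
  rw [abs_le]
  constructor
  · linarith [h2 0, h2 1, h2 2, h3 0, h3 1, h3 2]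
  · linarith [h1 0, h1 1, h1 2, h5 0, h5 1, h5 2]

lemma abs_fourier3_le (n : ℕ) (w : Fin 3 → ℤ) :
    |fourier3 n w| ≤
      ((2 * Real.pi) ^ 3)⁻¹ * (Real.exp 1 * √(6 * Real.pi ^ 3) ^ 3) / √((n : ℝ) + 1) ^ 3 := by
  have hpi := Real.pi_pos
  have hn : (0 : ℝ) < n + 1 := by positivity
  set b : ℝ := (6 * Real.pi ^ 2)⁻¹ * (n + 1) with hb
  have hbpos : 0 < b := by positivity
  have hg : ∫ k : Fin 3 → ℝ, ∏ i, Real.exp (-b * k i ^ 2) = √(Real.pi / b) ^ 3 := by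
    rw [integral_fintype_prod_volume_eq_prod (fun _ x => Real.exp (-b * x ^ 2))]
    simp_rw [integral_gaussian]
    simp
  have hgi : Integrable fun k : Fin 3 → ℝ => ∏ i, Real.exp (-b * k i ^ 2) :=
    Integrable.fintype_prod (f := fun _ x => Real.exp (-b * x ^ 2))
      fun _ => integrable_exp_neg_mul_sq hbpos
  have hmeas : (Measure.pi fun _ : Fin 3 => circleMeasure) =
      (volume : Measure (Fin 3 → ℝ)).restrict
        (Set.univ.pi fun _ => Set.Ico (-Real.pi) Real.pi) :=
    (Measure.restrict_pi_pi _ _).symm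
  have hms : MeasurableSet (Set.univ.pi fun _ : Fin 3 => Set.Ico (-Real.pi) Real.pi) :=
    MeasurableSet.univ_pi fun _ => measurableSet_Ico
  rw [fourier3, abs_mul, abs_of_nonneg (by positivity : 0 ≤ ((2 * Real.pi) ^ 3)⁻¹), mul_div_assoc]
  refine mul_le_mul_of_nonneg_left ?_ (by positivity)
  have hle : |∫ k : Fin 3 → ℝ, charFun3 k ^ n * ∏ i, Real.cos (k i * w i)
      ∂(Measure.pi fun _ => circleMeasure)| ≤
      ∫ k : Fin 3 → ℝ, Real.exp 1 * ∏ i, Real.exp (-b * k i ^ 2)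
        ∂(Measure.pi fun _ => circleMeasure) := by
    rw [← Real.norm_eq_abs, hmeas]
    refine norm_integral_le_of_norm_le (hgi.const_mul _).integrableOn ?_
    refine (ae_restrict_iff' hms).2 (Eventually.of_forall fun k hk => ?_)
    have hk' : ∀ i, |k i| ≤ Real.pi := fun i =>
      abs_le.2 ⟨(hk i (Set.mem_univ i)).1, (hk i (Set.mem_univ i)).2.le⟩
    have hsum : (6 * Real.pi ^ 2)⁻¹ * ∑ i, k i ^ 2 ≤ 1 := by
      rw [inv_mul_le_iff₀ (by positivity), Fin.sum_univ_three]
      have := fun i => sq_le_sq' (by linarith [abs_le.1 (hk' i)]) (abs_le.1 (hk' i)).2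
      linarith [this 0, this 1, this 2, sq_nonneg Real.pi]
    rw [norm_mul, norm_pow, Real.norm_eq_abs]
    have hc : ‖∏ i, Real.cos (k i * w i)‖ ≤ 1 := by
      rw [norm_prod]
      exact Finset.prod_le_one (fun _ _ => norm_nonneg _) fun i _ => Real.abs_cos_le_one _
    refine (mul_le_mul (pow_le_pow_left₀ (abs_nonneg _) (abs_charFun3_le k hk') n) hc
      (norm_nonneg _) (by positivity)).trans ?_
    rw [mul_one, ← Real.exp_sum, ← Real.exp_add, ← Real.exp_nat_mul, Real.exp_le_exp,
      ← Finset.mul_sum, hb]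
    linarith
  refine hle.trans ?_
  rw [integral_const_mul, mul_div_assoc]
  refine mul_le_mul_of_nonneg_left ?_ (by positivity)
  rw [hmeas]
  refine (setIntegral_le_integral hgi (Eventually.of_forall fun k =>
    Finset.prod_nonneg fun _ _ => Real.exp_nonneg _)).trans ?_
  rw [hg, ← div_pow, ← Real.sqrt_div (by positivity)]
  refine le_of_eq ?_
  congr 2
  rw [hb]
  field_simp

/-- Local central limit bound for the walk projected along a coordinate direction. -/
lemma exists_lineProb_le : ∃ C : ℝ, 0 < C ∧ ∀ (n : ℕ) (a : Fin 4) (y : Site),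
    lineProb n a y ≤ ENNReal.ofReal (C / √((n : ℝ) + 1) ^ 3) := by
  have := Real.pi_pos
  refine ⟨((2 * Real.pi) ^ 3)⁻¹ * (Real.exp 1 * √(6 * Real.pi ^ 3) ^ 3), by positivity,
    fun n a y => ?_⟩
  rw [(lineProb_eq_fourier3 n a y).2]
  exact ENNReal.ofReal_le_ofReal ((le_abs_self _).trans (abs_fourier3_le n _))

lemma lineProb_zero_eq (n : ℕ) (a b : Fin 4) : lineProb n a 0 = lineProb n b 0 := by
  rw [(lineProb_eq_fourier3 n a 0).2, (lineProb_eq_fourier3 n b 0).2]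
  rfl

lemma cGFF_eq : cGFF = (∑' n, lineProb n 0 0) / 8 := by
  simp only [cGFF, green, lineProb, div_eq_mul_inv, ENNReal.tsum_mul_right, sub_zero, zero_add]
  rw [ENNReal.tsum_comm]

/-- Exponential moments of a coordinate of the walk. -/
lemma tsum_srwProb_mul_exp_le (n : ℕ) (i : Fin 4) (l : ℝ) :
    ∑' x : Site, srwProb n x * ENNReal.ofReal (Real.exp (l * x i)) ≤
      ENNReal.ofReal (Real.exp (l ^ 2 * n / 2)) := by
  induction n with
  | zero =>
    rw [tsum_eq_single 0]
    · simp [srwProb]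
    · intro x hx
      simp [srwProb, hx]
  | succ n ih =>
    set M := ∑' x : Site, srwProb n x * ENNReal.ofReal (Real.exp (l * x i)) with hM
    have h1 : ∀ u : Site, ∑' x : Site, srwProb n (x + u) * ENNReal.ofReal (Real.exp (l * x i)) =
        M * ENNReal.ofReal (Real.exp (-(l * u i))) := by
      intro u
      rw [hM, ← ENNReal.tsum_mul_right, ← (Equiv.addRight u).tsum_eq
        fun x : Site => srwProb n x * ENNReal.ofReal (Real.exp (l * x i)) *
          ENNReal.ofReal (Real.exp (-(l * u i)))]
      refine tsum_congr fun x => ?_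
      rw [mul_assoc, ← ENNReal.ofReal_mul (Real.exp_nonneg _), ← Real.exp_add]
      simp only [Equiv.coe_addRight, Pi.add_apply]
      push_cast
      congr 3
      ring
    have h2 : ∀ u : Site, ∑' x : Site, srwProb n (x - u) * ENNReal.ofReal (Real.exp (l * x i)) =
        M * ENNReal.ofReal (Real.exp (l * u i)) := by
      intro u
      have := h1 (-u)
      simpa [← sub_eq_add_neg] using this
    have hcosh : ∀ k : Fin 4, ENNReal.ofReal (Real.exp (-(l * unit k i))) +
        ENNReal.ofReal (Real.exp (l * unit k i)) ≤ ENNReal.ofReal (2 * Real.cosh l) := by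
      intro k
      rw [← ENNReal.ofReal_add (Real.exp_nonneg _) (Real.exp_nonneg _)]
      refine ENNReal.ofReal_le_ofReal ?_
      rcases eq_or_ne i k with rfl | h
      · rw [Real.cosh_eq]
        simp
        linarith
      · rw [unit_apply_of_ne h]
        have := Real.one_le_cosh l
        simp
        linarith
    have h3 : ∑' x : Site, srwProb (n + 1) x * ENNReal.ofReal (Real.exp (l * x i)) =
        M * (∑ k, (ENNReal.ofReal (Real.exp (-(l * unit k i))) +
          ENNReal.ofReal (Real.exp (l * unit k i)))) / 8 := by
      have h0 : ∀ x : Site, srwProb (n + 1) x * ENNReal.ofReal (Real.exp (l * x i)) =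
          (∑ k, (srwProb n (x + unit k) + srwProb n (x - unit k)) *
            ENNReal.ofReal (Real.exp (l * x i))) / 8 := by
        intro x
        rw [srwProb, div_eq_mul_inv, mul_right_comm, Finset.sum_mul, ← div_eq_mul_inv]
      simp_rw [h0, div_eq_mul_inv, ENNReal.tsum_mul_right]
      rw [Summable.tsum_finsetSum fun _ _ => ENNReal.summable, Finset.mul_sum]
      congr 1
      refine Finset.sum_congr rfl fun k _ => ?_
      simp_rw [add_mul, ENNReal.tsum_add, h1, h2, mul_add]
    rw [h3, mul_div_assoc]
    have h4 : (∑ k, (ENNReal.ofReal (Real.exp (-(l * unit k i))) +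
          ENNReal.ofReal (Real.exp (l * unit k i)))) / 8 ≤ ENNReal.ofReal (Real.exp (l ^ 2 / 2)) := by
      refine ENNReal.div_le_of_le_mul ((Finset.sum_le_sum fun k _ => hcosh k).trans ?_)
      rw [Finset.sum_const, Finset.card_univ, Fintype.card_fin, nsmul_eq_mul,
        ← ENNReal.ofReal_ofNat 8, ← ENNReal.ofReal_natCast, ← ENNReal.ofReal_mul (by norm_num),
        ← ENNReal.ofReal_mul (by positivity)]
      refine ENNReal.ofReal_le_ofReal ?_
      have := Real.cosh_le_exp_half_sq l
      push_cast
      linarith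
    refine (mul_le_mul' ih h4).trans ?_
    rw [← ENNReal.ofReal_mul (Real.exp_nonneg _), ← Real.exp_add]
    refine ENNReal.ofReal_le_ofReal (Real.exp_le_exp.2 (le_of_eq ?_))
    push_cast
    ring

end RandomWalk

section GroupAlgebra

/-- Finitely supported functions on `ℤ⁴`, with convolution as product. -/
abbrev SiteAlg : Type := AddMonoidAlgebra ℝ Site

/-- The point mass at `x`. -/
noncomputable def pt (x : Site) : SiteAlg := AddMonoidAlgebra.single x 1

/-- Reflection of a function through the origin. -/
noncomputable def refl : SiteAlg →+* SiteAlg :=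
  AddMonoidAlgebra.mapDomainRingHom ℝ (negAddMonoidHom : Site →+ Site)

/-- The value at the origin, as an additive map. -/
noncomputable def atZero : SiteAlg →+ ℝ where
  toFun f := f.coeff 0
  map_zero' := rfl
  map_add' _ _ := rfl

lemma pt_mul_pt (x y : Site) : pt x * pt y = pt (x + y) := by
  simp [pt, AddMonoidAlgebra.single_mul_single]

lemma pt_zero : pt 0 = 1 := rfl

lemma refl_pt (x : Site) : refl (pt x) = pt (-x) := by
  simp [refl, pt]

lemma coeff_pt_mul (x : Site) (f : SiteAlg) (y : Site) : (pt x * f).coeff y = f.coeff (y - x) := by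
  rw [pt, AddMonoidAlgebra.coeff_single_mul_apply, one_mul, neg_add_eq_sub]

lemma refl_coeff (f : SiteAlg) (x : Site) : (refl f).coeff x = f.coeff (-x) := by
  have : refl f = AddMonoidAlgebra.mapDomain Neg.neg f := rfl
  rw [this, AddMonoidAlgebra.coeff_mapDomain]
  nth_rewrite 1 [← neg_neg x]
  exact Finsupp.mapDomain_apply neg_injective _ _

lemma refl_refl (f : SiteAlg) : refl (refl f) = f := by
  ext x
  rw [refl_coeff, refl_coeff, neg_neg]

lemma atZero_mul_refl (f g : SiteAlg) :
    atZero (f * refl g) = f.coeff.sum fun x r => r * g.coeff x := by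
  change (f * refl g).coeff 0 = _
  rw [AddMonoidAlgebra.coeff_mul_apply_left]
  refine Finsupp.sum_congr fun x _ => ?_
  rw [refl_coeff]
  simp

lemma atZero_mul_refl_pt (f : SiteAlg) (x : Site) : atZero (f * refl (pt x)) = f.coeff x := by
  rw [refl_pt, mul_comm]
  change (pt (-x) * f).coeff 0 = _
  rw [coeff_pt_mul]
  simp

/-- Finite partial sums of `∑ f(x)²` are dominated by the value at zero of `f * refl f`. -/
lemma sum_sq_le_atZero (s : Finset Site) (f : SiteAlg) :
    ∑ x ∈ s, f.coeff x ^ 2 ≤ atZero (f * refl f) := by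
  classical
  rw [atZero_mul_refl, Finsupp.sum]
  calc ∑ x ∈ s, f.coeff x ^ 2 ≤ ∑ x ∈ s ∪ f.coeff.support, f.coeff x ^ 2 :=
        Finset.sum_le_sum_of_subset_of_nonneg Finset.subset_union_left fun _ _ _ => sq_nonneg _
    _ = ∑ x ∈ f.coeff.support, f.coeff x * f.coeff x := by
        simp_rw [← sq]
        refine (Finset.sum_subset Finset.subset_union_right fun x _ hx => ?_).symm
        rw [Finsupp.notMem_support_iff.1 hx]
        norm_num

lemma atZero_mul_refl_nonneg (f : SiteAlg) : 0 ≤ atZero (f * refl f) := by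
  simpa using sum_sq_le_atZero ∅ f

/-- The constant `1/8`. -/
noncomputable def eighth : SiteAlg := AddMonoidAlgebra.single 0 (1 / 8)

lemma eight_mul_eighth : (8 : SiteAlg) * eighth = 1 := by
  have : (8 : SiteAlg) = AddMonoidAlgebra.single 0 8 := rfl
  rw [this, eighth, AddMonoidAlgebra.single_mul_single]
  norm_num
  rfl

lemma coeff_eighth_mul (f : SiteAlg) (x : Site) : (eighth * f).coeff x = f.coeff x / 8 := by
  rw [eighth, AddMonoidAlgebra.coeff_single_mul_apply]
  simp
  ring

lemma atZero_eighth_mul (f : SiteAlg) : atZero (eighth * f) = atZero f / 8 := coeff_eighth_mul f 0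

lemma refl_eighth : refl eighth = eighth := by
  simp [refl, eighth]

/-- One step of the simple random walk. -/
noncomputable def step : SiteAlg := eighth * ∑ i, (pt (unit i) + pt (-unit i))

lemma refl_step : refl step = step := by
  rw [step, map_mul, refl_eighth, map_sum]
  congr 1
  refine Finset.sum_congr rfl fun i _ => ?_
  rw [map_add, refl_pt, refl_pt, neg_neg, add_comm]

/-- Transition probabilities of the simple random walk as real numbers. -/
noncomputable def heat (n : ℕ) (x : Site) : ℝ := (srwProb n x).toReal

lemma heat_nonneg (n : ℕ) (x : Site) : 0 ≤ heat n x := ENNReal.toReal_nonneg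

lemma heat_succ (n : ℕ) (x : Site) :
    heat (n + 1) x = (∑ i, (heat n (x + unit i) + heat n (x - unit i))) / 8 := by
  rw [heat, srwProb, ENNReal.toReal_div, ENNReal.toReal_sum]
  · simp_rw [ENNReal.toReal_add (srwProb_ne_top _ _) (srwProb_ne_top _ _)]
    rfl
  · exact fun i _ => ENNReal.add_ne_top.2 ⟨srwProb_ne_top _ _, srwProb_ne_top _ _⟩

lemma coeff_step_pow (n : ℕ) (x : Site) : (step ^ n).coeff x = heat n x := by
  induction n generalizing x with
  | zero =>
    rw [pow_zero, heat, srwProb, ← pt_zero, pt]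
    simp only [AddMonoidAlgebra.coeff_single, Finsupp.single_apply, eq_comm (a := (0 : Site))]
    split_ifs <;> simp
  | succ n ih =>
    rw [pow_succ', step, mul_assoc, coeff_eighth_mul, heat_succ, Finset.sum_mul,
      AddMonoidAlgebra.coeff_sum, Finsupp.finsetSum_apply]
    congr 1
    refine Finset.sum_congr rfl fun i _ => ?_
    rw [add_mul, AddMonoidAlgebra.coeff_add, Finsupp.add_apply, coeff_pt_mul, coeff_pt_mul,
      ← step, ih, ih, sub_neg_eq_add, add_comm]

lemma pt_mul_pt_neg (x : Site) : pt x * pt (-x) = 1 := by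
  rw [pt_mul_pt, add_neg_cancel, pt_zero]

lemma sum_difference_sq :
    ∑ i, (pt (-unit i) - 1) * refl (pt (-unit i) - 1) = 8 * (1 - step) := by
  have h : (8 : SiteAlg) * (1 - step) = ∑ i : Fin 4, (2 - (pt (unit i) + pt (-unit i))) := by
    rw [mul_sub, step, ← mul_assoc, eight_mul_eighth, Finset.sum_sub_distrib]
    simp
    norm_num
  rw [h]
  refine Finset.sum_congr rfl fun i _ => ?_
  rw [map_sub, map_one, refl_pt, neg_neg]
  linear_combination pt_mul_pt_neg (unit i)

lemma eighth_mul_sum_sq :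
    eighth * ∑ i, (1 + pt (unit i)) * refl (1 + pt (unit i)) = 1 + step := by
  have h : ∑ i : Fin 4, (1 + pt (unit i)) * refl (1 + pt (unit i)) =
      8 + ∑ i : Fin 4, (pt (unit i) + pt (-unit i)) := by
    have : (8 : SiteAlg) = ∑ _i : Fin 4, 2 := by simp; norm_num
    rw [this, ← Finset.sum_add_distrib]
    refine Finset.sum_congr rfl fun i _ => ?_
    rw [map_add, map_one, refl_pt]
    linear_combination pt_mul_pt_neg (unit i)
  rw [h, mul_add, ← step, mul_comm, eight_mul_eighth]

lemma atZero_one_add_step_mul_nonneg (f : SiteAlg) :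
    0 ≤ atZero ((1 + step) * (f * refl f)) := by
  have h : (1 + step) * (f * refl f) = eighth *
      ∑ i, ((1 + pt (unit i)) * f) * refl ((1 + pt (unit i)) * f) := by
    rw [← eighth_mul_sum_sq, mul_assoc, Finset.sum_mul]
    congr 1
    refine Finset.sum_congr rfl fun i _ => ?_
    rw [map_mul]
    ring
  rw [h, atZero_eighth_mul, map_sum]
  exact div_nonneg (Finset.sum_nonneg fun i _ => atZero_mul_refl_nonneg _) (by norm_num)

/-- The truncated Green's function `(1/8) ∑_{n < N} P^n`. -/
noncomputable def truncGreen (N : ℕ) : SiteAlg := eighth * ∑ n ∈ Finset.range N, step ^ n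

lemma refl_truncGreen (N : ℕ) : refl (truncGreen N) = truncGreen N := by
  simp only [truncGreen, map_mul, refl_eighth, map_sum, map_pow, refl_step]

lemma laplacian_truncGreen (N : ℕ) : 8 * (1 - step) * truncGreen N = 1 - step ^ N := by
  rw [truncGreen]
  have := mul_neg_geom_sum step N
  linear_combination ((1 - step) * ∑ n ∈ Finset.range N, step ^ n) * eight_mul_eighth + this

lemma geom_sum_even (M : ℕ) : ∑ n ∈ Finset.range (2 * M), step ^ n =
    ∑ m ∈ Finset.range M, (1 + step) * (step ^ m * step ^ m) := by
  induction M with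
  | zero => simp
  | succ M ih =>
    rw [mul_add, mul_one, Finset.sum_range_succ, Finset.sum_range_succ, ih, Finset.sum_range_succ]
    ring

lemma atZero_truncGreen_mul_step_pow_nonneg (M : ℕ) (f : SiteAlg) :
    0 ≤ atZero (truncGreen (2 * M) * step ^ (2 * M) * (f * refl f)) := by
  have h : truncGreen (2 * M) * step ^ (2 * M) * (f * refl f) = eighth *
      ∑ m ∈ Finset.range M,
        (1 + step) * ((step ^ m * step ^ M * f) * refl (step ^ m * step ^ M * f)) := by
    rw [truncGreen, geom_sum_even, mul_assoc, mul_assoc, Finset.sum_mul]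
    congr 1
    refine Finset.sum_congr rfl fun m _ => ?_
    simp only [map_mul, map_pow, refl_step]
    ring
  rw [h, atZero_eighth_mul, map_sum]
  exact div_nonneg (Finset.sum_nonneg fun i _ => atZero_one_add_step_mul_nonneg _) (by norm_num)

/-- The `1`-form with components `φ`. -/
noncomputable def toForm (φ : Fin 4 → SiteAlg) (e : Edge) : ℝ := (φ e.2).coeff e.1

lemma dOne_toForm (φ : Fin 4 → SiteAlg) (x : Site) (i k : Fin 4) :
    dOne (toForm φ) (x, i, k) =
      ((pt (-unit i) - 1) * φ k - (pt (-unit k) - 1) * φ i).coeff x := by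
  simp only [dOne, toForm, sub_mul, one_mul, AddMonoidAlgebra.coeff_sub, Finsupp.sub_apply,
    coeff_pt_mul, sub_neg_eq_add]
  ring

lemma lagrange_identity {A : Type*} [CommRing A] (d e p q : Fin 4 → A) :
    ∑ k, (∑ i, d i * e i) * (p k * q k) =
      (∑ i, ∑ k, if i < k then (d i * p k - d k * p i) * (e i * q k - e k * q i) else 0) +
        (∑ i, e i * p i) * ∑ i, d i * q i := by
  simp [Fin.sum_univ_four]
  ring

/-- The energy of the exterior derivative of a `1`-form is at most its Dirichlet energy: the
difference is the energy of the codifferential. -/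
lemma sum_dOne_sq_le (F : Finset Plaquette) (hF : ∀ f ∈ F, f.2.1 < f.2.2) (φ : Fin 4 → SiteAlg) :
    ∑ f ∈ F, dOne (toForm φ) f ^ 2 ≤
      ∑ k, atZero (8 * (1 - step) * (φ k * refl (φ k))) := by
  classical
  set d : Fin 4 → SiteAlg := fun i => pt (-unit i) - 1 with hd
  have h1 : ∑ f ∈ F, dOne (toForm φ) f ^ 2 ≤
      ∑ i, ∑ k, if i < k then
        atZero ((d i * φ k - d k * φ i) * refl (d i * φ k - d k * φ i)) else 0 := by
    have hmap : ∀ f ∈ F, f.2 ∈ (Finset.univ : Finset (Fin 4 × Fin 4)) := fun _ _ =>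
      Finset.mem_univ _
    rw [← Finset.sum_fiberwise_of_maps_to hmap, ← Finset.univ_product_univ, Finset.sum_product]
    refine Finset.sum_le_sum fun i _ => Finset.sum_le_sum fun k _ => ?_
    split_ifs with hik
    · have hinj : Set.InjOn (fun f : Plaquette => f.1) (F.filter fun f => f.2 = (i, k)) := by
        intro f hf g hg hfg
        simp only [Finset.coe_filter, Set.mem_ofPred_eq] at hf hg
        exact Prod.ext hfg (hf.2.trans hg.2.symm)
      refine le_trans (le_of_eq ?_) (sum_sq_le_atZero
        ((F.filter fun f => f.2 = (i, k)).image fun f => f.1) _)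
      rw [Finset.sum_image hinj]
      refine Finset.sum_congr rfl fun f hf => ?_
      obtain ⟨x, y⟩ := f
      obtain rfl : y = (i, k) := (Finset.mem_filter.1 hf).2
      rw [dOne_toForm]
    · refine le_of_eq (Finset.sum_eq_zero fun f hf => absurd (hF f (Finset.mem_filter.1 hf).1) ?_)
      rw [(Finset.mem_filter.1 hf).2]
      exact hik
  refine h1.trans ?_
  have h2 := atZero_mul_refl_nonneg (∑ i, refl (d i) * φ i)
  have h3 : ∑ k, atZero (8 * (1 - step) * (φ k * refl (φ k))) =
      (∑ i, ∑ k, if i < k then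
        atZero ((d i * φ k - d k * φ i) * refl (d i * φ k - d k * φ i)) else 0) +
        atZero ((∑ i, refl (d i) * φ i) * refl (∑ i, refl (d i) * φ i)) := by
    have h4 : ∀ i k, (if i < k then
        atZero ((d i * φ k - d k * φ i) * refl (d i * φ k - d k * φ i)) else 0) =
        atZero (if i < k then (d i * φ k - d k * φ i) *
          (refl (d i) * refl (φ k) - refl (d k) * refl (φ i)) else 0) := by
      intro i k
      split_ifs
      · rw [map_sub refl, map_mul refl, map_mul refl]
      · rw [map_zero]
    rw [← sum_difference_sq]
    change ∑ k, atZero ((∑ i, d i * refl (d i)) * (φ k * refl (φ k))) = _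
    simp only [h4, ← map_sum, ← map_add]
    rw [lagrange_identity, map_sum]
    simp only [map_mul, refl_refl]
  linarith

end GroupAlgebra

section LoopEnergy

/-- Two parallel segments of `L` points in direction `e_a`, the second shifted by `v` and taken
with opposite sign. -/
noncomputable def segmentPair (a : Fin 4) (v c : Site) (L : ℕ) : SiteAlg :=
  ∑ s ∈ Finset.range L, (pt (c + (s : ℤ) • unit a) - pt (c + v + (s : ℤ) • unit a))

lemma atZero_mul_pt_refl_pt (f : SiteAlg) (x y : Site) :
    atZero (f * (pt x * refl (pt y))) = f.coeff (y - x) := by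
  rw [← mul_assoc, atZero_mul_refl_pt, mul_comm, coeff_pt_mul]

lemma atZero_step_pow_segmentPair (n : ℕ) (a : Fin 4) (v c : Site) (L : ℕ) :
    atZero (step ^ n * (segmentPair a v c L * refl (segmentPair a v c L))) =
      ∑ s ∈ Finset.range L, ∑ t ∈ Finset.range L,
        (2 * heat n (0 + ((t : ℤ) - s) • unit a) - heat n (v + ((t : ℤ) - s) • unit a) -
          heat n (-v + ((t : ℤ) - s) • unit a)) := by
  rw [segmentPair, map_sum, Finset.sum_mul_sum, Finset.mul_sum, map_sum]
  refine Finset.sum_congr rfl fun s _ => ?_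
  rw [Finset.mul_sum, map_sum]
  refine Finset.sum_congr rfl fun t _ => ?_
  simp only [map_sub, sub_mul, mul_sub, atZero_mul_pt_refl_pt, coeff_step_pow]
  rw [show c + (t : ℤ) • unit a - (c + (s : ℤ) • unit a) = 0 + ((t : ℤ) - s) • unit a by module,
    show c + v + (t : ℤ) • unit a - (c + (s : ℤ) • unit a) = v + ((t : ℤ) - s) • unit a by module,
    show c + (t : ℤ) • unit a - (c + v + (s : ℤ) • unit a) = -v + ((t : ℤ) - s) • unit a by module,
    show c + v + (t : ℤ) • unit a - (c + v + (s : ℤ) • unit a) = 0 + ((t : ℤ) - s) • unit a by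
      module]
  ring

lemma lineProb_ne_top (n : ℕ) (a : Fin 4) (y : Site) : lineProb n a y ≠ ∞ := by
  obtain ⟨C, _, h⟩ := exists_lineProb_le
  exact ((h n a y).trans_lt ENNReal.ofReal_lt_top).ne

lemma sum_heat_eq_toReal (n : ℕ) (a : Fin 4) (v : Site) (m : ℤ) (L : ℕ) :
    ∑ t ∈ Finset.range L, heat n (v + ((t : ℤ) - m) • unit a) =
      (∑ t ∈ (Finset.range L).map Nat.castEmbedding,
        srwProb n (v + (t - m) • unit a)).toReal := by
  rw [ENNReal.toReal_sum fun _ _ => srwProb_ne_top _ _, Finset.sum_map]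
  rfl

lemma tsum_srwProb_line (n : ℕ) (a : Fin 4) (v : Site) (m : ℤ) :
    ∑' t : ℤ, srwProb n (v + (t - m) • unit a) = lineProb n a v :=
  (Equiv.subRight m).tsum_eq fun k : ℤ => srwProb n (v + k • unit a)

lemma sum_heat_le (n : ℕ) (a : Fin 4) (v : Site) (m : ℤ) (L : ℕ) :
    ∑ t ∈ Finset.range L, heat n (v + ((t : ℤ) - m) • unit a) ≤ (lineProb n a v).toReal := by
  rw [sum_heat_eq_toReal, ← tsum_srwProb_line n a v m]
  refine ENNReal.toReal_mono ?_ (ENNReal.sum_le_tsum _)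
  rw [tsum_srwProb_line]
  exact lineProb_ne_top n a v

lemma sum_heat_eq (n : ℕ) (a : Fin 4) (s L : ℕ) (h1 : n ≤ s) (h2 : s + n < L) :
    ∑ t ∈ Finset.range L, heat n (0 + ((t : ℤ) - s) • unit a) = (lineProb n a 0).toReal := by
  rw [sum_heat_eq_toReal, ← tsum_srwProb_line n a 0 s, tsum_eq_sum]
  intro t ht
  refine srwProb_eq_zero (i := a) ?_
  have : ¬ (0 ≤ t ∧ t < L) := by
    rintro ⟨h3, h4⟩
    apply ht
    rw [Finset.mem_map]
    exact ⟨t.toNat, by simp; omega, by simp; omega⟩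
  simp
  rw [lt_abs]
  omega

lemma segmentPair_energy_ge (n : ℕ) (a : Fin 4) (v c : Site) (L : ℕ) :
    2 * ((L : ℝ) - 2 * n) * (lineProb n 0 0).toReal -
      L * ((lineProb n a v).toReal + (lineProb n a (-v)).toReal) ≤
    atZero (step ^ n * (segmentPair a v c L * refl (segmentPair a v c L))) := by
  rw [atZero_step_pow_segmentPair]
  simp only [Finset.sum_sub_distrib, ← Finset.mul_sum]
  have h1 : ∀ w : Site, ∑ s ∈ Finset.range L, ∑ t ∈ Finset.range L,
      heat n (w + ((t : ℤ) - s) • unit a) ≤ L * (lineProb n a w).toReal := by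
    intro w
    refine (Finset.sum_le_sum fun (s : ℕ) _ => sum_heat_le n a w s L).trans ?_
    simp
  have h2 : ((L : ℝ) - 2 * n) * (lineProb n 0 0).toReal ≤
      ∑ s ∈ Finset.range L, ∑ t ∈ Finset.range L, heat n (0 + ((t : ℤ) - s) • unit a) := by
    calc ((L : ℝ) - 2 * n) * (lineProb n 0 0).toReal
        ≤ ((L - n - n : ℕ) : ℝ) * (lineProb n 0 0).toReal := by
          refine mul_le_mul_of_nonneg_right ?_ ENNReal.toReal_nonneg
          have : L ≤ (L - n - n) + 2 * n := by omega
          have : (L : ℝ) ≤ ((L - n - n : ℕ) : ℝ) + 2 * n := by exact_mod_cast this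
          linarith
      _ = ∑ s ∈ Finset.Ico n (L - n), ∑ t ∈ Finset.range L,
            heat n (0 + ((t : ℤ) - s) • unit a) := by
          rw [Finset.sum_congr rfl fun s hs => ?_, Finset.sum_const, Nat.card_Ico, nsmul_eq_mul]
          rw [Finset.mem_Ico] at hs
          rw [sum_heat_eq n a s L hs.1 (by omega), lineProb_zero_eq n a 0]
      _ ≤ _ := by
          refine Finset.sum_le_sum_of_subset_of_nonneg ?_ fun s _ _ =>
            Finset.sum_nonneg fun t _ => heat_nonneg _ _
          intro s hs
          rw [Finset.mem_Ico] at hs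
          rw [Finset.mem_range]
          omega
  linarith [h1 v, h1 (-v)]

namespace Rectangle

/-- The boundary loop of `R` as an integer `1`-form. -/
noncomputable def current (R : Rectangle) (i : Fin 4) : SiteAlg :=
  (if i = R.a then segmentPair R.a ((R.H : ℤ) • unit R.b) R.corner R.L else 0) -
    (if i = R.b then segmentPair R.b ((R.L : ℤ) • unit R.a) R.corner R.H else 0)

lemma current_a (R : Rectangle) :
    R.current R.a = segmentPair R.a ((R.H : ℤ) • unit R.b) R.corner R.L := by
  simp [current, R.a_ne_b]

lemma current_b (R : Rectangle) :
    R.current R.b = -segmentPair R.b ((R.L : ℤ) • unit R.a) R.corner R.H := by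
  simp [current, R.a_ne_b.symm]

lemma current_of_ne (R : Rectangle) {i : Fin 4} (ha : i ≠ R.a) (hb : i ≠ R.b) :
    R.current i = 0 := by
  simp [current, ha, hb]

lemma sum_current {M : Type*} [AddCommMonoid M] (R : Rectangle) (g : Fin 4 → SiteAlg → M)
    (hg : ∀ i, g i 0 = 0) :
    ∑ i, g i (R.current i) = g R.a (R.current R.a) + g R.b (R.current R.b) := by
  refine Finset.sum_eq_add R.a R.b R.a_ne_b (fun i _ hi => ?_) (by simp) (by simp)
  rw [R.current_of_ne hi.1 hi.2, hg]

lemma loopSum_toForm (R : Rectangle) (φ : Fin 4 → SiteAlg) :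
    R.loopSum (toForm φ) = ∑ i, atZero (φ i * refl (R.current i)) := by
  rw [R.sum_current (fun i f => atZero (φ i * refl f)) (by simp), R.current_a, R.current_b]
  simp only [segmentPair, map_sum, map_neg, map_sub, mul_neg, Finset.mul_sum, mul_sub,
    atZero_mul_refl_pt, loopSum, toForm, point, Finset.sum_sub_distrib]
  simp only [Nat.cast_zero, zero_smul, add_zero, add_right_comm R.corner ((R.H : ℤ) • unit R.b)]
  ring

/-- The truncated Green's function applied to the loop. -/
noncomputable def spinWave (R : Rectangle) (N : ℕ) (i : Fin 4) : SiteAlg :=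
  truncGreen N * R.current i

/-- The energy of the loop with respect to the truncated Green's function. -/
noncomputable def energy (R : Rectangle) (N : ℕ) : ℝ := R.loopSum (toForm (R.spinWave N))

lemma energy_eq (R : Rectangle) (N : ℕ) :
    R.energy N = ∑ i, atZero (truncGreen N * (R.current i * refl (R.current i))) := by
  rw [energy, loopSum_toForm]
  simp only [spinWave, mul_assoc]

lemma sum_dOne_spinWave_sq_le (R : Rectangle) (M : ℕ) (F : Finset Plaquette)
    (hF : ∀ f ∈ F, f.2.1 < f.2.2) :
    ∑ f ∈ F, dOne (toForm (R.spinWave (2 * M))) f ^ 2 ≤ R.energy (2 * M) := by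
  refine (sum_dOne_sq_le F hF _).trans ?_
  rw [energy_eq]
  refine Finset.sum_le_sum fun k _ => ?_
  have h := atZero_truncGreen_mul_step_pow_nonneg M (R.current k)
  have h2 : 8 * (1 - step) * (R.spinWave (2 * M) k * refl (R.spinWave (2 * M) k)) =
      truncGreen (2 * M) * (R.current k * refl (R.current k)) -
        truncGreen (2 * M) * step ^ (2 * M) * (R.current k * refl (R.current k)) := by
    rw [spinWave, map_mul, refl_truncGreen]
    linear_combination (truncGreen (2 * M) * R.current k * refl (R.current k)) *
      laplacian_truncGreen (2 * M)
  rw [h2, map_sub]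
  linarith

lemma energy_ge (R : Rectangle) (N : ℕ) (X Y : ℕ → ℝ)
    (hX : ∀ n < N, (lineProb n R.a ((R.H : ℤ) • unit R.b)).toReal +
      (lineProb n R.a (-((R.H : ℤ) • unit R.b))).toReal ≤ X n)
    (hY : ∀ n < N, (lineProb n R.b ((R.L : ℤ) • unit R.a)).toReal +
      (lineProb n R.b (-((R.L : ℤ) • unit R.a))).toReal ≤ Y n) :
    ∑ n ∈ Finset.range N, (((R.perimeter : ℝ) - 8 * n) * (lineProb n 0 0).toReal / 8 -
      (R.L * X n + R.H * Y n) / 8) ≤ R.energy N := by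
  rw [energy_eq, R.sum_current (fun _ f => atZero (truncGreen N * (f * refl f))) (by simp),
    R.current_a, R.current_b]
  simp only [map_neg, neg_mul_neg, truncGreen, mul_assoc, atZero_eighth_mul]
  simp only [Finset.sum_mul, map_sum]
  rw [← add_div, ← Finset.sum_add_distrib, Finset.sum_div]
  refine Finset.sum_le_sum fun n hn => ?_
  rw [Finset.mem_range] at hn
  have h1 := segmentPair_energy_ge n R.a ((R.H : ℤ) • unit R.b) R.corner R.L
  have h2 := segmentPair_energy_ge n R.b ((R.L : ℤ) • unit R.a) R.corner R.H
  have h3 := mul_le_mul_of_nonneg_left (hX n hn) (Nat.cast_nonneg (α := ℝ) R.L)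
  have h4 := mul_le_mul_of_nonneg_left (hY n hn) (Nat.cast_nonneg (α := ℝ) R.H)
  simp only [perimeter]
  push_cast
  linarith

end Rectangle

end LoopEnergy

section Tails

lemma sum_heat_mul_exp_le (T : Finset Site) (n : ℕ) (i : Fin 4) (l : ℝ) :
    ∑ x ∈ T, heat n x * Real.exp (l * x i) ≤ Real.exp (l ^ 2 * n / 2) := by
  have h := (ENNReal.sum_le_tsum T).trans (tsum_srwProb_mul_exp_le n i l)
  have h2 := ENNReal.toReal_mono ENNReal.ofReal_ne_top h
  rw [ENNReal.toReal_ofReal (Real.exp_nonneg _), ENNReal.toReal_sum fun x _ =>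
    ENNReal.mul_ne_top (srwProb_ne_top _ _) ENNReal.ofReal_ne_top] at h2
  simpa only [heat, ENNReal.toReal_mul, ENNReal.toReal_ofReal (Real.exp_nonneg _)] using h2

lemma heat_le_one (n : ℕ) (x : Site) : heat n x ≤ 1 := by
  have := sum_heat_mul_exp_le {x} n 0 0
  simpa using this

/-- Chernoff bound for the walk to be far from the origin in some coordinate. -/
lemma sum_heat_far_le (T : Finset Site) (n : ℕ) {l D : ℝ} (hl : 0 ≤ l)
    (hT : ∀ x ∈ T, ∃ k, D ≤ |(x k : ℝ)|) :
    ∑ x ∈ T, heat n x ≤ 8 * Real.exp (l ^ 2 * n / 2 - l * D) := by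
  have h1 : ∀ x ∈ T, heat n x ≤ ∑ k : Fin 4, Real.exp (-(l * D)) *
      (heat n x * Real.exp (l * x k) + heat n x * Real.exp (-l * x k)) := by
    intro x hx
    obtain ⟨k, hk⟩ := hT x hx
    have hnn := heat_nonneg n x
    refine le_trans ?_ (Finset.single_le_sum (f := fun k : Fin 4 => Real.exp (-(l * D)) *
      (heat n x * Real.exp (l * x k) + heat n x * Real.exp (-l * x k)))
      (fun _ _ => by positivity) (Finset.mem_univ k))
    have h2 : Real.exp (l * D) ≤ Real.exp (l * x k) + Real.exp (-l * x k) := by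
      rcases le_abs.1 hk with h | h
      · exact (Real.exp_le_exp.2 (mul_le_mul_of_nonneg_left h hl)).trans
          (le_add_of_nonneg_right (Real.exp_nonneg _))
      · refine (Real.exp_le_exp.2 ?_).trans (le_add_of_nonneg_left (Real.exp_nonneg _))
        linarith [mul_le_mul_of_nonneg_left h hl]
    rw [← mul_add, mul_left_comm, Real.exp_neg]
    refine le_mul_of_one_le_right hnn ?_
    rw [inv_mul_eq_div, one_le_div (Real.exp_pos _)]
    exact h2
  refine (Finset.sum_le_sum h1).trans ?_
  rw [Finset.sum_comm]
  have h3 : ∀ k : Fin 4, ∑ x ∈ T, Real.exp (-(l * D)) *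
      (heat n x * Real.exp (l * x k) + heat n x * Real.exp (-l * x k)) ≤
      2 * Real.exp (l ^ 2 * n / 2 - l * D) := by
    intro k
    rw [← Finset.mul_sum, Finset.sum_add_distrib, sub_eq_add_neg, Real.exp_add]
    have h4 := sum_heat_mul_exp_le T n k l
    have h5 := sum_heat_mul_exp_le T n k (-l)
    rw [neg_sq] at h5
    have := Real.exp_pos (-(l * D))
    nlinarith
  refine (Finset.sum_le_sum fun k _ => h3 k).trans (le_of_eq ?_)
  simp
  ring

/-- Chernoff bound for the walk projected along a coordinate direction. -/
lemma lineProb_toReal_le_exp (n : ℕ) {a i : Fin 4} (hia : i ≠ a) (y : Site) (l : ℝ) :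
    (lineProb n a y).toReal ≤ Real.exp (l ^ 2 * n / 2 - l * y i) := by
  have h : lineProb n a y * ENNReal.ofReal (Real.exp (l * y i)) ≤
      ENNReal.ofReal (Real.exp (l ^ 2 * n / 2)) := by
    refine le_trans ?_ (tsum_srwProb_mul_exp_le n i l)
    have hinj : Function.Injective fun k : ℤ => y + k • unit a := by
      intro k m hkm
      have := congrFun hkm a
      simpa using this
    refine le_trans (le_of_eq ?_) (ENNReal.tsum_comp_le_tsum_of_injective hinj _)
    rw [lineProb, ← ENNReal.tsum_mul_right]
    refine tsum_congr fun k => ?_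
    simp [unit_apply_of_ne hia]
  have h2 := ENNReal.toReal_mono ENNReal.ofReal_ne_top h
  rw [ENNReal.toReal_mul, ENNReal.toReal_ofReal (Real.exp_nonneg _),
    ENNReal.toReal_ofReal (Real.exp_nonneg _)] at h2
  rw [Real.exp_sub, le_div_iff₀ (Real.exp_pos _)]
  exact h2

lemma coeff_truncGreen_mul_pt (N : ℕ) (z x : Site) :
    (truncGreen N * pt z).coeff x = (∑ n ∈ Finset.range N, heat n (x - z)) / 8 := by
  rw [mul_comm, coeff_pt_mul, truncGreen, coeff_eighth_mul, AddMonoidAlgebra.coeff_sum,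
    Finsupp.finsetSum_apply]
  simp only [coeff_step_pow]

lemma abs_coeff_truncGreen_mul_pt_le (N : ℕ) (z x : Site) :
    |(truncGreen N * pt z).coeff x| ≤ N / 8 := by
  rw [coeff_truncGreen_mul_pt, abs_of_nonneg (div_nonneg (Finset.sum_nonneg fun _ _ =>
    heat_nonneg _ _) (by norm_num))]
  refine div_le_div_of_nonneg_right ?_ (by norm_num)
  refine (Finset.sum_le_sum fun n _ => heat_le_one n _).trans ?_
  simp

lemma sum_abs_coeff_truncGreen_mul_pt_le (N : ℕ) (z : Site) (T : Finset Site) {l D : ℝ}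
    (hl : 0 ≤ l) (hT : ∀ x ∈ T, ∃ k, D ≤ |(x k : ℝ) - z k|) :
    ∑ x ∈ T, |(truncGreen N * pt z).coeff x| ≤ N * Real.exp (l ^ 2 * N / 2 - l * D) := by
  have h0 : ∀ x, |(truncGreen N * pt z).coeff x| = (∑ n ∈ Finset.range N, heat n (x - z)) / 8 := by
    intro x
    rw [coeff_truncGreen_mul_pt, abs_of_nonneg (div_nonneg (Finset.sum_nonneg fun _ _ =>
      heat_nonneg _ _) (by norm_num))]
  simp_rw [h0]
  rw [← Finset.sum_div, Finset.sum_comm, div_le_iff₀ (by norm_num)]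
  have h1 : ∀ n ∈ Finset.range N, ∑ x ∈ T, heat n (x - z) ≤
      8 * Real.exp (l ^ 2 * N / 2 - l * D) := by
    intro n hn
    rw [Finset.mem_range] at hn
    have h2 := sum_heat_far_le (T.map (Equiv.subRight z).toEmbedding) n hl (D := D) (by
      intro x hx
      obtain ⟨w, hw, rfl⟩ := Finset.mem_map.1 hx
      obtain ⟨k, hk⟩ := hT w hw
      refine ⟨k, ?_⟩
      simpa using hk)
    rw [Finset.sum_map] at h2
    refine le_trans h2 ?_
    have : (n : ℝ) ≤ N := by exact_mod_cast hn.le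
    gcongr
  refine (Finset.sum_le_sum h1).trans (le_of_eq ?_)
  rw [Finset.sum_const, Finset.card_range, nsmul_eq_mul]
  ring

lemma sum_sq_coeff_truncGreen_mul_segmentPair_le (N : ℕ) (a : Fin 4) (v c : Site) (L : ℕ)
    (T : Finset Site) {l D : ℝ} (hl : 0 ≤ l)
    (hT : ∀ x ∈ T, ∃ k, ∀ s < L, D ≤ |(x k : ℝ) - (c + (s : ℤ) • unit a) k| ∧
      D ≤ |(x k : ℝ) - (c + v + (s : ℤ) • unit a) k|) :
    ∑ x ∈ T, (truncGreen N * segmentPair a v c L).coeff x ^ 2 ≤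
      (N : ℝ) ^ 2 * (L : ℝ) ^ 2 * Real.exp (l ^ 2 * N / 2 - l * D) := by
  set B := Real.exp (l ^ 2 * N / 2 - l * D)
  have h0 : ∀ x, |(truncGreen N * segmentPair a v c L).coeff x| ≤
      ∑ s ∈ Finset.range L, (|(truncGreen N * pt (c + (s : ℤ) • unit a)).coeff x| +
        |(truncGreen N * pt (c + v + (s : ℤ) • unit a)).coeff x|) := by
    intro x
    rw [segmentPair, Finset.mul_sum, AddMonoidAlgebra.coeff_sum, Finsupp.finsetSum_apply]
    refine (Finset.abs_sum_le_sum_abs _ _).trans (Finset.sum_le_sum fun s _ => ?_)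
    rw [mul_sub, AddMonoidAlgebra.coeff_sub, Finsupp.sub_apply]
    exact abs_sub _ _
  have hsup : ∀ x, |(truncGreen N * segmentPair a v c L).coeff x| ≤ L * N / 4 := by
    intro x
    refine (h0 x).trans ((Finset.sum_le_sum fun s _ => add_le_add
      (abs_coeff_truncGreen_mul_pt_le N _ x) (abs_coeff_truncGreen_mul_pt_le N _ x)).trans
      (le_of_eq ?_))
    rw [Finset.sum_const, Finset.card_range, nsmul_eq_mul]
    ring
  have hsum : ∑ x ∈ T, |(truncGreen N * segmentPair a v c L).coeff x| ≤ L * (2 * (N * B)) := by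
    refine (Finset.sum_le_sum fun x _ => h0 x).trans ?_
    rw [Finset.sum_comm]
    have h1 : ∀ s ∈ Finset.range L,
        ∑ x ∈ T, (|(truncGreen N * pt (c + (s : ℤ) • unit a)).coeff x| +
        |(truncGreen N * pt (c + v + (s : ℤ) • unit a)).coeff x|) ≤ 2 * (N * B) := by
      intro s hs
      rw [Finset.mem_range] at hs
      rw [Finset.sum_add_distrib, two_mul]
      refine add_le_add (sum_abs_coeff_truncGreen_mul_pt_le N _ T hl fun x hx => ?_)
        (sum_abs_coeff_truncGreen_mul_pt_le N _ T hl fun x hx => ?_)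
      · obtain ⟨k, hk⟩ := hT x hx
        exact ⟨k, (hk s hs).1⟩
      · obtain ⟨k, hk⟩ := hT x hx
        exact ⟨k, (hk s hs).2⟩
    refine (Finset.sum_le_sum h1).trans (le_of_eq ?_)
    rw [Finset.sum_const, Finset.card_range, nsmul_eq_mul]
  have hB : 0 ≤ B := Real.exp_nonneg _
  calc ∑ x ∈ T, (truncGreen N * segmentPair a v c L).coeff x ^ 2
      ≤ ∑ x ∈ T, (L * N / 4) * |(truncGreen N * segmentPair a v c L).coeff x| := by
        refine Finset.sum_le_sum fun x _ => ?_
        rw [← sq_abs, sq]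
        exact mul_le_mul_of_nonneg_right (hsup x) (abs_nonneg _)
    _ ≤ (L * N / 4) * (L * (2 * (N * B))) := by
        rw [← Finset.mul_sum]
        exact mul_le_mul_of_nonneg_left hsum (by positivity)
    _ = (N : ℝ) ^ 2 * (L : ℝ) ^ 2 * B / 2 := by ring
    _ ≤ _ := half_le_self (by positivity)

end Tails

section Cutoff

/-- The four edges of a plaquette. -/
noncomputable def plaquetteEdge (f : Plaquette) : Fin 4 → Edge :=
  ![(f.1, f.2.1), (f.1 + unit f.2.1, f.2.2), (f.1 + unit f.2.2, f.2.1), (f.1, f.2.2)]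

lemma dOne_sq_le (a : Edge → ℝ) (f : Plaquette) :
    dOne a f ^ 2 ≤ 4 * ∑ m, a (plaquetteEdge f m) ^ 2 := by
  have h : ∀ p q r s : ℝ, (p + q - r - s) ^ 2 ≤ 4 * (p ^ 2 + q ^ 2 + r ^ 2 + s ^ 2) := by
    intro p q r s
    nlinarith [sq_nonneg (p - q), sq_nonneg (p + r), sq_nonneg (p + s), sq_nonneg (q + r),
      sq_nonneg (q + s), sq_nonneg (r - s)]
  simp only [Fin.sum_univ_four]
  exact h _ _ _ _

lemma plaquetteEdge_injOn (m : Fin 4) {f g : Plaquette} (h : f.2 = g.2)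
    (hm : plaquetteEdge f m = plaquetteEdge g m) : f = g := by
  obtain ⟨x, y⟩ := f
  obtain ⟨x', y'⟩ := g
  obtain rfl : y = y' := h
  fin_cases m <;> simpa [plaquetteEdge] using hm

/-- Each edge belongs to boundedly many plaquettes. -/
lemma sum_plaquetteEdge_le (F : Finset Plaquette) (g : Edge → ℝ) (p : Edge → Prop) {B : ℝ}
    (hp : ∀ f ∈ F, ∀ m, p (plaquetteEdge f m))
    (hB : ∀ T : Finset Edge, (∀ e ∈ T, p e) → ∑ e ∈ T, g e ≤ B) :
    ∑ f ∈ F, ∑ m, g (plaquetteEdge f m) ≤ 64 * B := by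
  classical
  rw [Finset.sum_comm]
  have h1 : ∀ m, ∑ f ∈ F, g (plaquetteEdge f m) ≤ 16 * B := by
    intro m
    have hmap : ∀ f ∈ F, f.2 ∈ (Finset.univ : Finset (Fin 4 × Fin 4)) := fun _ _ =>
      Finset.mem_univ _
    rw [← Finset.sum_fiberwise_of_maps_to hmap]
    have h2 : ∀ y ∈ (Finset.univ : Finset (Fin 4 × Fin 4)),
        ∑ f ∈ F with f.2 = y, g (plaquetteEdge f m) ≤ B := by
      intro y _
      rw [← Finset.sum_image (s := F.filter fun f => f.2 = y)
        (g := fun f => plaquetteEdge f m)]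
      · refine hB _ fun e he => ?_
        obtain ⟨f, hf, rfl⟩ := Finset.mem_image.1 he
        exact hp f (Finset.mem_filter.1 hf).1 m
      · intro f hf g hg hfg
        rw [Finset.mem_coe, Finset.mem_filter] at hf hg
        exact plaquetteEdge_injOn m (hf.2.trans hg.2.symm) hfg
    refine (Finset.sum_le_sum h2).trans (le_of_eq ?_)
    simp
  refine (Finset.sum_le_sum fun m _ => h1 m).trans (le_of_eq ?_)
  simp
  ring

/-- Cost of setting a `1`-form to zero outside a set of edges. -/
lemma sum_dOne_cutoff_sq_le (F : Finset Plaquette) (S : Finset Edge) (a : Edge → ℝ)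
    (p : Edge → Prop) {B : ℝ}
    (hp : ∀ f ∈ F, (∃ m, plaquetteEdge f m ∉ S) → ∀ m, p (plaquetteEdge f m))
    (hB : ∀ T : Finset Edge, (∀ e ∈ T, p e) → ∑ e ∈ T, a e ^ 2 ≤ B) :
    ∑ f ∈ F, dOne (fun e => if e ∈ S then a e else 0) f ^ 2 ≤
      ∑ f ∈ F, dOne a f ^ 2 + 256 * B := by
  classical
  rw [← Finset.sum_filter_add_sum_filter_not F fun f => ∀ m, plaquetteEdge f m ∈ S]
  refine add_le_add ?_ ?_
  · refine le_trans (le_of_eq (Finset.sum_congr rfl fun f hf => ?_))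
      (Finset.sum_le_sum_of_subset_of_nonneg (Finset.filter_subset _ _)
        fun _ _ _ => sq_nonneg _)
    have hm := (Finset.mem_filter.1 hf).2
    have h0 := hm 0
    have h1 := hm 1
    have h2 := hm 2
    have h3 := hm 3
    simp only [plaquetteEdge, Matrix.cons_val] at h0 h1 h2 h3
    simp only [dOne, h0, h1, h2, h3, if_true]
  · have h1 := sum_plaquetteEdge_le (F.filter fun f => ¬ ∀ m, plaquetteEdge f m ∈ S)
      (fun e => a e ^ 2) p (fun f hf => hp f (Finset.mem_filter.1 hf).1
        (not_forall.1 (Finset.mem_filter.1 hf).2)) hB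
    refine (Finset.sum_le_sum fun f _ => dOne_sq_le _ f).trans ?_
    rw [← Finset.mul_sum]
    have h2 : ∑ f ∈ F with ¬ ∀ m, plaquetteEdge f m ∈ S,
        ∑ m, (if plaquetteEdge f m ∈ S then a (plaquetteEdge f m) else 0) ^ 2 ≤
        ∑ f ∈ F with ¬ ∀ m, plaquetteEdge f m ∈ S, ∑ m, a (plaquetteEdge f m) ^ 2 := by
      refine Finset.sum_le_sum fun f _ => Finset.sum_le_sum fun m _ => ?_
      split_ifs
      · exact le_rfl
      · simpa using sq_nonneg _
    linarith

end Cutoff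

section Geometry

lemma mem_boxSites {j : ℕ} {x : Site} : x ∈ boxSites j ↔ ∀ k, |x k| ≤ (j : ℤ) := by
  simp [boxSites, abs_le]

lemma unit_nonneg (i k : Fin 4) : 0 ≤ unit i k := by
  rcases eq_or_ne k i with rfl | h
  · simp
  · rw [unit_apply_of_ne h]

lemma unit_le_one (i k : Fin 4) : unit i k ≤ 1 := by
  rcases eq_or_ne k i with rfl | h
  · simp
  · rw [unit_apply_of_ne h]; norm_num

namespace Rectangle

lemma FarFromBoundary.mono {R : Rectangle} {j D D' : ℕ} (h : R.FarFromBoundary j D)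
    (hD : D' ≤ D) : R.FarFromBoundary j D' := fun s hs t ht k =>
  lt_of_le_of_lt (by exact_mod_cast hD) (h s hs t ht k)

lemma FarFromBoundary.allowed {R : Rectangle} {j D : ℕ} (h : R.FarFromBoundary j D)
    (bc : BoundaryCondition) : R.Allowed j bc := by
  cases bc with
  | zero => exact h.mono (Nat.zero_le _)
  | free =>
    intro s hs t ht
    rw [mem_boxSites]
    intro k
    have := h s hs t ht k
    have : (0 : ℤ) ≤ D := Int.natCast_nonneg D
    linarith

lemma point_succ_left (R : Rectangle) (s t : ℕ) :
    R.point s t + unit R.a = R.point (s + 1) t := by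
  simp only [point]
  push_cast
  module

lemma point_succ_right (R : Rectangle) (s t : ℕ) :
    R.point s t + unit R.b = R.point s (t + 1) := by
  simp only [point]
  push_cast
  module

lemma Allowed.mem_activeEdges {R : Rectangle} {j : ℕ} {bc : BoundaryCondition}
    (h : R.Allowed j bc) {s t s' t' : ℕ} {i : Fin 4} (hs : s ≤ R.L) (ht : t ≤ R.H)
    (hs' : s' ≤ R.L) (ht' : t' ≤ R.H) (hst : R.point s t + unit i = R.point s' t') :
    (R.point s t, i) ∈ activeEdges j bc := by
  have hbox : ∀ s ≤ R.L, ∀ t ≤ R.H, R.point s t ∈ boxSites j := by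
    cases bc with
    | free => exact h
    | zero => exact FarFromBoundary.allowed (D := 0) h .free
  have hmem : (R.point s t, i) ∈ boxEdges j := by
    rw [boxEdges, Finset.mem_filter, Finset.mem_product]
    refine ⟨⟨hbox s hs t ht, Finset.mem_univ _⟩, ?_⟩
    rw [hst]
    exact hbox s' hs' t' ht'
  cases bc with
  | free => exact hmem
  | zero =>
    classical
    refine Finset.mem_filter.2 ⟨hmem, ?_⟩
    rintro ⟨k, _, hk⟩
    have := h s hs t ht k
    simp only [hk] at this
    simp at this

/-- All edges of the boundary loop belong to `S`. -/
structure LoopSubset (R : Rectangle) (S : Finset Edge) : Prop where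
  left : ∀ s < R.L, ∀ t, t = 0 ∨ t = R.H → (R.point s t, R.a) ∈ S
  right : ∀ t < R.H, ∀ s, s = 0 ∨ s = R.L → (R.point s t, R.b) ∈ S

lemma Allowed.loopSubset {R : Rectangle} {j : ℕ} {bc : BoundaryCondition}
    (h : R.Allowed j bc) : R.LoopSubset (activeEdges j bc) where
  left s hs t ht := by
    have ht' : t ≤ R.H := by omega
    exact h.mem_activeEdges hs.le ht' hs ht' (R.point_succ_left s t)
  right t ht s hs := by
    have hs' : s ≤ R.L := by omega
    exact h.mem_activeEdges hs' ht.le hs' ht (R.point_succ_right s t)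

lemma LoopSubset.loopSum_cutoff {R : Rectangle} {S : Finset Edge} (h : R.LoopSubset S)
    (a : Edge → ℝ) : R.loopSum (fun e => if e ∈ S then a e else 0) = R.loopSum a := by
  unfold loopSum
  congr 1
  · congr 1
    · congr 1
      · exact Finset.sum_congr rfl fun s hs =>
          if_pos (h.left s (Finset.mem_range.1 hs) 0 (Or.inl rfl))
      · exact Finset.sum_congr rfl fun t ht =>
          if_pos (h.right t (Finset.mem_range.1 ht) R.L (Or.inr rfl))
    · exact Finset.sum_congr rfl fun s hs =>
        if_pos (h.left s (Finset.mem_range.1 hs) R.H (Or.inr rfl))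
  · exact Finset.sum_congr rfl fun t ht =>
      if_pos (h.right t (Finset.mem_range.1 ht) 0 (Or.inl rfl))

lemma segment_a_eq (R : Rectangle) (s : ℕ) :
    R.corner + (s : ℤ) • unit R.a = R.point s 0 ∧
      R.corner + (R.H : ℤ) • unit R.b + (s : ℤ) • unit R.a = R.point s R.H := by
  simp only [point]
  constructor
  · simp
  · abel

lemma segment_b_eq (R : Rectangle) (t : ℕ) :
    R.corner + (t : ℤ) • unit R.b = R.point 0 t ∧
      R.corner + (R.L : ℤ) • unit R.a + (t : ℤ) • unit R.b = R.point R.L t := by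
  simp [point]

end Rectangle

lemma coeff_segmentPair_eq_zero {a : Fin 4} {v c x : Site} {L : ℕ}
    (h : ∀ s < L, c + (s : ℤ) • unit a ≠ x ∧ c + v + (s : ℤ) • unit a ≠ x) :
    (segmentPair a v c L).coeff x = 0 := by
  rw [segmentPair, AddMonoidAlgebra.coeff_sum, Finsupp.finsetSum_apply]
  refine Finset.sum_eq_zero fun s hs => ?_
  have := h s (Finset.mem_range.1 hs)
  rw [AddMonoidAlgebra.coeff_sub, Finsupp.sub_apply, pt, pt, AddMonoidAlgebra.coeff_single,
    AddMonoidAlgebra.coeff_single, Finsupp.single_apply, Finsupp.single_apply, if_neg this.1,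
    if_neg this.2, sub_zero]

lemma Rectangle.LoopSubset.current_eq_zero {R : Rectangle} {S : Finset Edge}
    (h : R.LoopSubset S) {e : Edge} (he : e ∉ S) : toForm R.current e = 0 := by
  obtain ⟨x, i⟩ := e
  unfold toForm
  rcases eq_or_ne i R.a with rfl | ha
  · simp only [R.current_a]
    refine coeff_segmentPair_eq_zero fun s hs => ?_
    rw [(R.segment_a_eq s).1, (R.segment_a_eq s).2]
    exact ⟨fun h' => he (h' ▸ h.left s hs 0 (Or.inl rfl)),
      fun h' => he (h' ▸ h.left s hs R.H (Or.inr rfl))⟩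
  · rcases eq_or_ne i R.b with rfl | hb
    · simp only [R.current_b, AddMonoidAlgebra.coeff_neg, Finsupp.neg_apply, neg_eq_zero]
      refine coeff_segmentPair_eq_zero fun s hs => ?_
      rw [(R.segment_b_eq s).1, (R.segment_b_eq s).2]
      exact ⟨fun h' => he (h' ▸ h.right s hs 0 (Or.inl rfl)),
        fun h' => he (h' ▸ h.right s hs R.L (Or.inr rfl))⟩
    · simp only [R.current_of_ne ha hb, AddMonoidAlgebra.coeff_zero, Finsupp.zero_apply]

lemma activePlaquettes_subset (j : ℕ) (bc : BoundaryCondition) :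
    activePlaquettes j bc ⊆ boxPlaquettes j := by
  cases bc with
  | free => exact subset_rfl
  | zero =>
    classical
    exact Finset.filter_subset _ _

lemma lt_of_mem_activePlaquettes {j : ℕ} {bc : BoundaryCondition} {f : Plaquette}
    (hf : f ∈ activePlaquettes j bc) : f.2.1 < f.2.2 :=
  (Finset.mem_filter.1 (activePlaquettes_subset j bc hf)).2.1

lemma plaquetteEdge_bounds (f : Plaquette) (m k : Fin 4) :
    f.1 k ≤ (plaquetteEdge f m).1 k ∧ (plaquetteEdge f m).1 k ≤ f.1 k + 1 ∧
      ((plaquetteEdge f m).1 + unit (plaquetteEdge f m).2) k ≤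
        (f.1 + unit f.2.1 + unit f.2.2) k := by
  have h1 := unit_nonneg f.2.1 k
  have h2 := unit_nonneg f.2.2 k
  have h3 := unit_le_one f.2.1 k
  have h4 := unit_le_one f.2.2 k
  fin_cases m <;> simp [plaquetteEdge] <;> omega

lemma plaquetteEdge_mem_boxEdges {j : ℕ} {f : Plaquette} (hf : f ∈ boxPlaquettes j) (m : Fin 4) :
    plaquetteEdge f m ∈ boxEdges j := by
  rw [boxPlaquettes, Finset.mem_filter, Finset.mem_product, mem_boxSites, mem_boxSites] at hf
  rw [boxEdges, Finset.mem_filter, Finset.mem_product, mem_boxSites, mem_boxSites]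
  have hb := plaquetteEdge_bounds f m
  refine ⟨⟨fun k => ?_, Finset.mem_univ _⟩, fun k => ?_⟩
  · have h1 := abs_le.1 (hf.1.1 k)
    have h2 := abs_le.1 (hf.2.2 k)
    have h3 := hb k
    have h4 := unit_nonneg (plaquetteEdge f m).2 k
    rw [Pi.add_apply (plaquetteEdge f m).1] at h3
    rw [abs_le]
    constructor <;> linarith
  · have h1 := abs_le.1 (hf.1.1 k)
    have h2 := abs_le.1 (hf.2.2 k)
    have h3 := hb k
    have h4 := unit_nonneg (plaquetteEdge f m).2 k
    have h5 : ((plaquetteEdge f m).1 + unit (plaquetteEdge f m).2) k =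
      (plaquetteEdge f m).1 k + unit (plaquetteEdge f m).2 k := rfl
    rw [abs_le]
    constructor <;> linarith

/-- The edge `e` is at distance at least `D` from the rectangle in some coordinate. -/
def Rectangle.FarEdge (R : Rectangle) (D : ℝ) (e : Edge) : Prop :=
  ∃ k, ∀ s ≤ R.L, ∀ t ≤ R.H, D ≤ |(e.1 k : ℝ) - R.point s t k|

lemma Rectangle.FarFromBoundary.farEdge {R : Rectangle} {j D : ℕ} (h : R.FarFromBoundary j D)
    {bc : BoundaryCondition} {f : Plaquette} (hf : f ∈ activePlaquettes j bc)
    (hm : ∃ m, plaquetteEdge f m ∉ activeEdges j bc) (m : Fin 4) :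
    R.FarEdge D (plaquetteEdge f m) := by
  obtain ⟨m', hm'⟩ := hm
  have hbox := plaquetteEdge_mem_boxEdges (activePlaquettes_subset j bc hf) m'
  cases bc with
  | free => exact absurd hbox hm'
  | zero =>
    have hbd : IsBoundaryEdge j (plaquetteEdge f m') := by
      classical
      by_contra hb
      exact hm' (Finset.mem_filter.2 ⟨hbox, hb⟩)
    obtain ⟨k, _, hk⟩ := hbd
    refine ⟨k, fun s hs t ht => ?_⟩
    have h1 := h s hs t ht k
    have h2 := plaquetteEdge_bounds f m k
    have h3 := plaquetteEdge_bounds f m' k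
    have h4 : (D : ℤ) ≤ |(plaquetteEdge f m).1 k - R.point s t k| := by
      have h5 : (j : ℤ) - 1 ≤ |(plaquetteEdge f m).1 k| := by
        have := abs_sub_abs_le_abs_sub ((plaquetteEdge f m').1 k) ((plaquetteEdge f m).1 k)
        have h6 : |(plaquetteEdge f m').1 k - (plaquetteEdge f m).1 k| ≤ 1 := by
          rw [abs_le]
          omega
        linarith
      have h7 := abs_sub_abs_le_abs_sub ((plaquetteEdge f m).1 k) (R.point s t k)
      omega
    exact_mod_cast h4

lemma Rectangle.sum_sq_spinWave_far_le (R : Rectangle) (N : ℕ) {l D : ℝ} (hl : 0 ≤ l)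
    (T : Finset Edge) (hT : ∀ e ∈ T, R.FarEdge D e) :
    ∑ e ∈ T, toForm (R.spinWave N) e ^ 2 ≤
      (N : ℝ) ^ 2 * ((R.L : ℝ) ^ 2 + (R.H : ℝ) ^ 2) * Real.exp (l ^ 2 * N / 2 - l * D) := by
  classical
  have hmap : ∀ e ∈ T, e.2 ∈ (Finset.univ : Finset (Fin 4)) := fun _ _ => Finset.mem_univ _
  rw [← Finset.sum_fiberwise_of_maps_to hmap]
  have h1 : ∀ i : Fin 4, ∑ e ∈ T with e.2 = i, toForm (R.spinWave N) e ^ 2 =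
      ∑ x ∈ (T.filter fun e => e.2 = i).image fun e => e.1,
        (truncGreen N * R.current i).coeff x ^ 2 := by
    intro i
    rw [Finset.sum_image]
    · refine Finset.sum_congr rfl fun e he => ?_
      rw [toForm, spinWave, (Finset.mem_filter.1 he).2]
    · intro e he g hg heg
      rw [Finset.mem_coe, Finset.mem_filter] at he hg
      exact Prod.ext heg (he.2.trans hg.2.symm)
  simp_rw [h1]
  rw [R.sum_current (fun i f => ∑ x ∈ (T.filter fun e => e.2 = i).image fun e => e.1,
    (truncGreen N * f).coeff x ^ 2) (by simp), R.current_a, R.current_b]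
  simp only [mul_neg, AddMonoidAlgebra.coeff_neg, Finsupp.neg_apply, neg_sq]
  rw [mul_add, add_mul]
  refine add_le_add (sum_sq_coeff_truncGreen_mul_segmentPair_le N _ _ _ _ _ hl fun x hx => ?_)
    (sum_sq_coeff_truncGreen_mul_segmentPair_le N _ _ _ _ _ hl fun x hx => ?_)
  · obtain ⟨e, he, rfl⟩ := Finset.mem_image.1 hx
    obtain ⟨k, hk⟩ := hT e (Finset.mem_filter.1 he).1
    refine ⟨k, fun s hs => ?_⟩
    rw [(R.segment_a_eq s).1, (R.segment_a_eq s).2]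
    exact ⟨hk s hs.le 0 (Nat.zero_le _), hk s hs.le R.H le_rfl⟩
  · obtain ⟨e, he, rfl⟩ := Finset.mem_image.1 hx
    obtain ⟨k, hk⟩ := hT e (Finset.mem_filter.1 he).1
    refine ⟨k, fun s hs => ?_⟩
    rw [(R.segment_b_eq s).1, (R.segment_b_eq s).2]
    exact ⟨hk 0 (Nat.zero_le _) s hs.le, hk R.L le_rfl s hs.le⟩

lemma Rectangle.eventually_farFromBoundary (R : Rectangle) (D : ℕ) :
    ∀ᶠ j in atTop, R.FarFromBoundary j D := by
  have h : ∀ s ∈ Finset.range (R.L + 1), ∀ t ∈ Finset.range (R.H + 1), ∀ k ∈ Finset.univ (α := Fin 4),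
      ∀ᶠ j : ℕ in atTop, (D : ℤ) < (j : ℤ) - |R.point s t k| := by
    intro s _ t _ k _
    filter_upwards [eventually_gt_atTop (D + (R.point s t k).natAbs)] with j hj
    rw [Int.abs_eq_natAbs]
    omega
  simp only [← Finset.eventually_all] at h
  filter_upwards [h] with j hj s hs t ht k
  exact hj s (Finset.mem_range.2 (by omega)) t (Finset.mem_range.2 (by omega)) k (Finset.mem_univ k)

end Geometry

section Bounds

lemma dOne_const_mul (r : ℝ) (a : Edge → ℝ) (f : Plaquette) :
    dOne (fun e => r * a e) f = r * dOne a f := by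
  simp only [dOne]
  ring

lemma Rectangle.loopSum_const_mul (R : Rectangle) (r : ℝ) (a : Edge → ℝ) :
    R.loopSum (fun e => r * a e) = r * R.loopSum a := by
  simp only [Rectangle.loopSum, ← Finset.mul_sum]
  ring

lemma lineProb_zero_zero : (lineProb 0 0 0).toReal = 1 := by
  rw [lineProb, tsum_eq_single 0]
  · simp [srwProb]
  · intro k hk
    simp only [srwProb]
    rw [if_neg]
    intro h
    have := congrFun h 0
    simp at this
    exact hk this

lemma Rectangle.perimeter_le_loopSum_current (R : Rectangle) :
    (R.perimeter : ℝ) ≤ R.loopSum (toForm R.current) := by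
  have hne : ∀ {i k : Fin 4}, i ≠ k → ∀ m : ℕ, 0 < m →
      lineProb 0 i ((m : ℤ) • unit k) = 0 ∧ lineProb 0 i (-((m : ℤ) • unit k)) = 0 := by
    intro i k hik m hm
    constructor <;> refine lineProb_eq_zero hik.symm ?_ <;> simpa [abs_pos] using hm
  have h1 := segmentPair_energy_ge 0 R.a ((R.H : ℤ) • unit R.b) R.corner R.L
  have h2 := segmentPair_energy_ge 0 R.b ((R.L : ℤ) • unit R.a) R.corner R.H
  rw [(hne R.a_ne_b R.H R.H_pos).1, (hne R.a_ne_b R.H R.H_pos).2, lineProb_zero_zero] at h1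
  rw [(hne R.a_ne_b.symm R.L R.L_pos).1, (hne R.a_ne_b.symm R.L R.L_pos).2,
    lineProb_zero_zero] at h2
  rw [loopSum_toForm, R.sum_current (fun _ f => atZero (f * refl f)) (by simp), R.current_a,
    R.current_b]
  simp only [map_neg, neg_mul_neg]
  simp only [pow_zero, one_mul, Nat.cast_zero, mul_zero, sub_zero, mul_one, ENNReal.toReal_zero,
    add_zero] at h1 h2
  simp only [perimeter]
  push_cast
  linarith

lemma Rectangle.sum_dOne_current_sq_le (R : Rectangle) (F : Finset Plaquette)
    (hF : ∀ f ∈ F, f.2.1 < f.2.2) :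
    ∑ f ∈ F, dOne (toForm R.current) f ^ 2 ≤ 16 * R.loopSum (toForm R.current) := by
  refine (sum_dOne_sq_le F hF _).trans ?_
  rw [loopSum_toForm, Finset.mul_sum]
  refine Finset.sum_le_sum fun k _ => ?_
  have h := atZero_one_add_step_mul_nonneg (R.current k)
  have h8 : ∀ f : SiteAlg, atZero (8 * f) = 8 * atZero f := by
    intro f
    have := map_nsmul atZero 8 f
    simpa only [nsmul_eq_mul, Nat.cast_ofNat] using this
  have h2 : 8 * (1 - step) * (R.current k * refl (R.current k)) =
      8 * (R.current k * refl (R.current k)) + 8 * (R.current k * refl (R.current k)) -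
        8 * ((1 + step) * (R.current k * refl (R.current k))) := by ring
  rw [h2, map_sub, map_add, h8, h8]
  linarith

/-- Perimeter law upper bound at every inverse temperature. -/
lemma norm_integral_wilson_le_perimeter {β : ℝ} (hβ : 0 < β) (R : Rectangle)
    {bc : BoundaryCondition} {j : ℕ} (h : R.Allowed j bc) :
    ‖∫ θ, R.wilson θ ∂(villain β bc j)‖ ≤ Real.exp (-(1 / (32 * β) * R.perimeter)) := by
  refine (norm_integral_wilson_le hβ bc j R (fun e => 1 / (16 * β) * toForm R.current e)
    fun e he => ?_).trans ?_
  · rw [h.loopSubset.current_eq_zero he, mul_zero]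
  · rw [Real.exp_le_exp, neg_le_neg_iff, R.loopSum_const_mul]
    simp only [dOne_const_mul, mul_pow, ← Finset.mul_sum]
    have h1 := R.sum_dOne_current_sq_le (activePlaquettes j bc)
      fun f hf => lt_of_mem_activePlaquettes hf
    have h2 := R.perimeter_le_loopSum_current
    calc 1 / (32 * β) * (R.perimeter : ℝ) ≤ 1 / (32 * β) * R.loopSum (toForm R.current) := by
          gcongr
      _ = 1 / (16 * β) * R.loopSum (toForm R.current) - β / 2 * ((1 / (16 * β)) ^ 2 *
            (16 * R.loopSum (toForm R.current))) := by
          field_simp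
          ring
      _ ≤ _ := by gcongr

/-- Spin-wave bound with the truncated Green's function, cut off at the frozen edges. -/
lemma norm_integral_wilson_le_energy {β : ℝ} (hβ : 0 < β) (R : Rectangle)
    (bc : BoundaryCondition) {j D : ℕ} (h : R.FarFromBoundary j D) (M : ℕ) {l : ℝ} (hl : 0 ≤ l) :
    ‖∫ θ, R.wilson θ ∂(villain β bc j)‖ ≤ Real.exp (-(1 / (2 * β) * (R.energy (2 * M) -
      256 * (((2 * M : ℕ) : ℝ) ^ 2 * ((R.L : ℝ) ^ 2 + (R.H : ℝ) ^ 2) *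
        Real.exp (l ^ 2 * ((2 * M : ℕ) : ℝ) / 2 - l * D))))) := by
  classical
  set S := activeEdges j bc
  set B := ((2 * M : ℕ) : ℝ) ^ 2 * ((R.L : ℝ) ^ 2 + (R.H : ℝ) ^ 2) *
    Real.exp (l ^ 2 * ((2 * M : ℕ) : ℝ) / 2 - l * D)
  set φ := toForm (R.spinWave (2 * M)) with hφ
  refine (norm_integral_wilson_le hβ bc j R (fun e => 1 / β * (if e ∈ S then φ e else 0))
    fun e he => ?_).trans ?_
  · rw [if_neg he, mul_zero]
  · rw [Real.exp_le_exp, neg_le_neg_iff, R.loopSum_const_mul,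
      (h.allowed bc).loopSubset.loopSum_cutoff]
    simp only [dOne_const_mul, mul_pow, ← Finset.mul_sum]
    have h1 := sum_dOne_cutoff_sq_le (activePlaquettes j bc) S φ (R.FarEdge D) (B := B)
      (fun f hf hm m => h.farEdge hf hm m) (fun T hT => R.sum_sq_spinWave_far_le _ hl T hT)
    have h2 := R.sum_dOne_spinWave_sq_le M (activePlaquettes j bc)
      fun f hf => lt_of_mem_activePlaquettes hf
    calc 1 / (2 * β) * (R.energy (2 * M) - 256 * B) =
          1 / β * R.loopSum φ - β / 2 * ((1 / β) ^ 2 * (R.energy (2 * M) + 256 * B)) := by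
          rw [← Rectangle.energy]
          field_simp
          ring
      _ ≤ _ := by
          gcongr
          exact h1.trans (by linarith)

end Bounds

section Asymptotics

lemma inv_sqrt_cube_le {m : ℝ} (hm : 1 ≤ m) : 1 / √m ^ 3 ≤ 6 / √m - 6 / √(m + 1) := by
  have hu : 1 ≤ √m := Real.one_le_sqrt.2 hm
  have hu2 : √m ^ 2 = m := Real.sq_sqrt (by linarith)
  have hv2 : √(m + 1) ^ 2 = m + 1 := Real.sq_sqrt (by linarith)
  have huv : √m ≤ √(m + 1) := Real.sqrt_le_sqrt (by linarith)
  set u := √m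
  set v := √(m + 1)
  have hv : 0 < v := by linarith
  have hv' : v ≤ 2 * u := by
    refine le_of_sq_le_sq ?_ (by linarith)
    nlinarith
  have h1 : 6 / u - 6 / v = 6 / (u * v * (u + v)) := by
    have : (v - u) * (u + v) = 1 := by linear_combination hv2 - hu2
    field_simp
    linear_combination this
  rw [h1, div_le_div_iff₀ (by positivity) (by positivity)]
  nlinarith [mul_le_mul_of_nonneg_left hv' (by linarith : 0 ≤ u), mul_pos hv hv,
    mul_nonneg (by linarith : 0 ≤ u) (by nlinarith : 0 ≤ 6 * u ^ 2 - v * (u + v))]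

lemma sum_Ico_inv_sqrt_cube_le (a b : ℕ) :
    ∑ n ∈ Finset.Ico a b, 1 / √((n : ℝ) + 1) ^ 3 ≤ 6 / √((a : ℝ) + 1) := by
  rcases le_total b a with h | h
  · rw [Finset.Ico_eq_empty_of_le h, Finset.sum_empty]
    positivity
  · have key : ∑ n ∈ Finset.Ico a b, 1 / √((n : ℝ) + 1) ^ 3 ≤
        6 / √((a : ℝ) + 1) - 6 / √((b : ℝ) + 1) := by
      induction b, h using Nat.le_induction with
      | base => simp
      | succ b hb ih =>
        rw [Finset.sum_Ico_succ_top hb]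
        have h1 := inv_sqrt_cube_le (m := (b : ℝ) + 1) (by linarith [Nat.cast_nonneg (α := ℝ) b])
        push_cast
        linarith
    have : 0 ≤ 6 / √((b : ℝ) + 1) := by positivity
    linarith

lemma sum_range_inv_sqrt_le (N : ℕ) :
    ∑ n ∈ Finset.range N, 1 / √((n : ℝ) + 1) ≤ 2 * √(N : ℝ) := by
  induction N with
  | zero => simp
  | succ N ih =>
    rw [Finset.sum_range_succ]
    push_cast
    have h0 : (0 : ℝ) ≤ N := Nat.cast_nonneg N
    have hu2 : √(N : ℝ) ^ 2 = N := Real.sq_sqrt h0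
    have hv2 : √((N : ℝ) + 1) ^ 2 = N + 1 := Real.sq_sqrt (by linarith)
    have hv : 0 < √((N : ℝ) + 1) := Real.sqrt_pos.2 (by linarith)
    have hd : 1 / √((N : ℝ) + 1) ≤ 2 * √((N : ℝ) + 1) - 2 * √(N : ℝ) := by
      rw [div_le_iff₀ hv]
      nlinarith [sq_nonneg (√((N : ℝ) + 1) - √(N : ℝ))]
    linarith

variable {C : ℝ}

lemma lineProb_toReal_le {n : ℕ} {a : Fin 4} {y : Site} (hC0 : 0 < C)
    (hC : lineProb n a y ≤ ENNReal.ofReal (C / √((n : ℝ) + 1) ^ 3)) :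
    (lineProb n a y).toReal ≤ C * (1 / √((n : ℝ) + 1) ^ 3) := by
  have := ENNReal.toReal_mono ENNReal.ofReal_ne_top hC
  rwa [ENNReal.toReal_ofReal (by positivity), div_eq_mul_one_div] at this

lemma cGFF_le (hC0 : 0 < C) (hC : ∀ (n : ℕ) (a : Fin 4) (y : Site),
    lineProb n a y ≤ ENNReal.ofReal (C / √((n : ℝ) + 1) ^ 3)) (N : ℕ) :
    cGFF ≤ ENNReal.ofReal ((∑ n ∈ Finset.range N, (lineProb n 0 0).toReal +
      C * (6 / √((N : ℝ) + 1))) / 8) := by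
  rw [cGFF_eq, ENNReal.ofReal_div_of_pos (by norm_num), ENNReal.ofReal_ofNat]
  refine ENNReal.div_le_div_right (ENNReal.tsum_le_of_sum_range_le fun n => ?_) _
  rw [← ENNReal.ofReal_toReal (ENNReal.sum_ne_top.2 fun k _ => lineProb_ne_top k 0 0)]
  refine ENNReal.ofReal_le_ofReal ?_
  rw [ENNReal.toReal_sum fun k _ => lineProb_ne_top k 0 0]
  calc ∑ k ∈ Finset.range n, (lineProb k 0 0).toReal
      ≤ ∑ k ∈ Finset.range N ∪ Finset.Ico N n, (lineProb k 0 0).toReal := by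
        refine Finset.sum_le_sum_of_subset_of_nonneg (fun k hk => ?_)
          fun _ _ _ => ENNReal.toReal_nonneg
        simp only [Finset.mem_union, Finset.mem_range, Finset.mem_Ico] at hk ⊢
        omega
    _ = ∑ k ∈ Finset.range N, (lineProb k 0 0).toReal +
          ∑ k ∈ Finset.Ico N n, (lineProb k 0 0).toReal := by
        refine Finset.sum_union (Finset.disjoint_left.2 fun k hk hk' => ?_)
        simp only [Finset.mem_range, Finset.mem_Ico] at hk hk'
        omega
    _ ≤ _ := by
        gcongr
        refine (Finset.sum_le_sum fun k _ => lineProb_toReal_le hC0 (hC k 0 0)).trans ?_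
        rw [← Finset.mul_sum]
        exact mul_le_mul_of_nonneg_left (sum_Ico_inv_sqrt_cube_le N n) hC0.le

lemma cGFF_ne_top : cGFF ≠ ∞ := by
  obtain ⟨C, hC0, hC⟩ := exists_lineProb_le
  exact ((cGFF_le hC0 hC 0).trans_lt ENNReal.ofReal_lt_top).ne

lemma cGFF_toReal_pos : 0 < cGFF.toReal := by
  refine ENNReal.toReal_pos ?_ cGFF_ne_top
  rw [cGFF_eq]
  refine (ENNReal.div_pos_iff.2 ⟨?_, by norm_num⟩).ne'
  intro h
  have h0 := lineProb_zero_zero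
  rw [ENNReal.tsum_eq_zero.1 h 0] at h0
  simp at h0

lemma pow_mul_exp_neg_le {x : ℝ} : x ^ 16 * Real.exp (-(x ^ 2 / 2)) ≤ 2 ^ 8 * 40320 := by
  have h := Real.pow_div_factorial_le_exp (x ^ 2 / 2) (by positivity) 8
  have h8 : ((Nat.factorial 8 : ℕ) : ℝ) = 40320 := by norm_num [Nat.factorial]
  rw [h8, div_le_iff₀ (by norm_num)] at h
  rw [Real.exp_neg, ← div_eq_mul_inv, div_le_iff₀ (Real.exp_pos _)]
  have : x ^ 16 = 2 ^ 8 * (x ^ 2 / 2) ^ 8 := by ring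
  rw [this, mul_assoc]
  linarith

/-- Scales attached to a rectangle: `L = x³`, `x² ≤ H ≤ x⁴` and `N ≈ x⁴`. -/
structure Scale (R : Rectangle) (x : ℝ) (M : ℕ) : Prop where
  one_le : 1 ≤ x
  L_eq : (R.L : ℝ) = x ^ 3
  le_H : x ^ 2 ≤ R.H
  H_le : (R.H : ℝ) ≤ x ^ 4
  N_le : ((2 * M : ℕ) : ℝ) ≤ x ^ 4
  lt_N : x ^ 4 < ((2 * M : ℕ) : ℝ) + 2

lemma Rectangle.SufficientlySquare.exists_scale {R : Rectangle} (h : R.SufficientlySquare) :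
    ∃ (x : ℝ) (M : ℕ), Scale R x M ∧ (R.L : ℝ) ^ (2 / 3 : ℝ) = x ^ 2 := by
  have hL : (1 : ℝ) ≤ R.L := by exact_mod_cast R.L_pos
  have hL0 : (0 : ℝ) ≤ R.L := by linarith
  have hpow : ∀ k : ℕ, ((R.L : ℝ) ^ (1 / 3 : ℝ)) ^ k = (R.L : ℝ) ^ ((k : ℝ) / 3) := by
    intro k
    rw [← Real.rpow_natCast, ← Real.rpow_mul hL0]
    congr 1
    ring
  have h2 := hpow 2
  have h3 := hpow 3
  have h4 := hpow 4
  push_cast at h2 h3 h4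
  rw [div_self (by norm_num), Real.rpow_one] at h3
  refine ⟨(R.L : ℝ) ^ (1 / 3 : ℝ), ⌊((R.L : ℝ) ^ (1 / 3 : ℝ)) ^ 4 / 2⌋₊,
    ⟨Real.one_le_rpow hL (by norm_num), h3.symm, ?_, ?_, ?_, ?_⟩, h2.symm⟩
  · rw [h2]
    exact (Real.rpow_le_rpow_of_exponent_le hL (by norm_num)).trans h.1
  · rw [h4]
    exact h.2
  · have := Nat.floor_le (a := ((R.L : ℝ) ^ (1 / 3 : ℝ)) ^ 4 / 2) (by positivity)
    push_cast
    linarith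
  · have := Nat.lt_floor_add_one (((R.L : ℝ) ^ (1 / 3 : ℝ)) ^ 4 / 2)
    push_cast
    linarith

variable {R : Rectangle} {x : ℝ} {M : ℕ}

lemma Scale.exp_le (h : Scale R x M) {n : ℕ} (hn : n ≤ 2 * M) :
    Real.exp ((1 / x) ^ 2 * n / 2 - 1 / x * R.L) ≤ Real.exp (-(x ^ 2 / 2)) := by
  have hx : 0 < x := by linarith [h.one_le]
  rw [Real.exp_le_exp, h.L_eq]
  have h1 : (n : ℝ) ≤ x ^ 4 := (Nat.cast_le.2 hn).trans h.N_le
  have h2 : (1 / x) ^ 2 * n / 2 ≤ (1 / x) ^ 2 * x ^ 4 / 2 := by gcongr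
  have h3 : (1 / x) ^ 2 * x ^ 4 / 2 = x ^ 2 / 2 := by field_simp
  have h4 : 1 / x * x ^ 3 = x ^ 2 := by field_simp
  linarith

lemma Scale.cutoff_error_le (h : Scale R x M) :
    ((2 * M : ℕ) : ℝ) ^ 2 * ((R.L : ℝ) ^ 2 + (R.H : ℝ) ^ 2) *
      Real.exp ((1 / x) ^ 2 * ((2 * M : ℕ) : ℝ) / 2 - 1 / x * R.L) ≤ 2 * (2 ^ 8 * 40320) := by
  have hx := h.one_le
  have hL : (R.L : ℝ) ≤ x ^ 4 := by
    rw [h.L_eq]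
    exact pow_le_pow_right₀ hx (by norm_num)
  calc _ ≤ (x ^ 4) ^ 2 * ((x ^ 4) ^ 2 + (x ^ 4) ^ 2) * Real.exp (-(x ^ 2 / 2)) := by
        gcongr
        · exact h.N_le
        · exact h.H_le
        · exact Real.exp_le_exp.1 (h.exp_le le_rfl)
    _ = 2 * (x ^ 16 * Real.exp (-(x ^ 2 / 2))) := by ring
    _ ≤ _ := by linarith [pow_mul_exp_neg_le (x := x)]

lemma exists_energy_ge : ∃ K : ℝ, ∀ (R : Rectangle) (x : ℝ) (M : ℕ), Scale R x M →
    cGFF.toReal * R.perimeter - K * x ^ 2 ≤ R.energy (2 * M) := by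
  obtain ⟨C, hC0, hC⟩ := exists_lineProb_le
  refine ⟨6 * C + 2 * C + 12 * C / 8 + 2 * (2 ^ 8 * 40320) / 8, fun R x M h => ?_⟩
  have hx := h.one_le
  have hx0 : 0 < x := by linarith
  set N := 2 * M
  set q : ℕ → ℝ := fun n => (lineProb n 0 0).toReal with hq
  set X : ℕ → ℝ := fun n => if n < R.H then 0 else 2 * C * (1 / √((n : ℝ) + 1) ^ 3) with hX
  set Y : ℝ := 2 * Real.exp (-(x ^ 2 / 2)) with hY
  have hE := R.energy_ge N X (fun _ => Y) (by
    intro n _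
    simp only [hX]
    split_ifs with hn
    · rw [lineProb_eq_zero R.a_ne_b.symm, lineProb_eq_zero R.a_ne_b.symm]
      · simp
      · simpa using hn
      · simpa using hn
    · have h1 := lineProb_toReal_le hC0 (hC n R.a ((R.H : ℤ) • unit R.b))
      have h2 := lineProb_toReal_le hC0 (hC n R.a (-((R.H : ℤ) • unit R.b)))
      linarith) (by
    intro n hn
    have h1 := (lineProb_toReal_le_exp n R.a_ne_b ((R.L : ℤ) • unit R.a) (1 / x))
    have h2 := (lineProb_toReal_le_exp n R.a_ne_b (-((R.L : ℤ) • unit R.a)) (-(1 / x)))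
    have h3 := h.exp_le hn.le
    have e1 : ((((R.L : ℤ) • unit R.a) R.a : ℤ) : ℝ) = R.L := by simp
    have e2 : (((-((R.L : ℤ) • unit R.a)) R.a : ℤ) : ℝ) = -R.L := by simp
    rw [e1] at h1
    rw [e2, neg_sq, neg_mul_neg] at h2
    linarith)
  have hsplit : ∑ n ∈ Finset.range N, (((R.perimeter : ℝ) - 8 * n) * q n / 8 -
      (R.L * X n + R.H * Y) / 8) = R.perimeter * ((∑ n ∈ Finset.range N, q n) / 8) -
      ∑ n ∈ Finset.range N, n * q n - R.L * (∑ n ∈ Finset.range N, X n) / 8 -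
      N * (R.H * Y) / 8 := by
    have e : ∀ n ∈ Finset.range N, ((R.perimeter : ℝ) - 8 * n) * q n / 8 -
      (R.L * X n + R.H * Y) / 8 = (R.perimeter : ℝ) / 8 * q n - n * q n - R.L / 8 * X n -
        R.H * Y / 8 := fun n _ => by ring
    rw [Finset.sum_congr rfl e, Finset.sum_sub_distrib, Finset.sum_sub_distrib,
      Finset.sum_sub_distrib, ← Finset.mul_sum, ← Finset.mul_sum, Finset.sum_const,
      Finset.card_range, nsmul_eq_mul]
    ring
  rw [hsplit] at hE
  have hL : (R.L : ℝ) ≤ x ^ 4 := by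
    rw [h.L_eq]
    exact pow_le_pow_right₀ hx (by norm_num)
  have hN := h.N_le
  have hH := h.H_le
  -- the tail of the Green's function
  have b1 : cGFF.toReal ≤ (∑ n ∈ Finset.range N, q n) / 8 + C * 6 * 2 / (8 * x ^ 2) := by
    have h1 := ENNReal.toReal_mono ENNReal.ofReal_ne_top (cGFF_le hC0 hC N)
    rw [ENNReal.toReal_ofReal (div_nonneg (add_nonneg (Finset.sum_nonneg fun _ _ =>
      ENNReal.toReal_nonneg) (by positivity)) (by norm_num)), add_div] at h1
    have h2 : x ^ 2 / 2 ≤ √((N : ℝ) + 1) := by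
      refine Real.le_sqrt_of_sq_le ?_
      have := h.lt_N
      have h4 : 1 ≤ x ^ 4 := one_le_pow₀ hx
      nlinarith
    have h3 : C * (6 / √((N : ℝ) + 1)) / 8 ≤ C * (6 / (x ^ 2 / 2)) / 8 := by gcongr
    have h4 : C * (6 / (x ^ 2 / 2)) / 8 = C * 6 * 2 / (8 * x ^ 2) := by
      field_simp
    linarith
  have hper : (R.perimeter : ℝ) ≤ 4 * x ^ 4 := by
    simp only [Rectangle.perimeter]
    push_cast
    linarith
  have b2 : R.perimeter * (C * 6 * 2 / (8 * x ^ 2)) ≤ 6 * C * x ^ 2 := by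
    calc R.perimeter * (C * 6 * 2 / (8 * x ^ 2)) ≤ 4 * x ^ 4 * (C * 6 * 2 / (8 * x ^ 2)) := by
          gcongr
      _ = 6 * C * x ^ 2 := by
          field_simp
          ring
  -- the corners
  have b3 : ∑ n ∈ Finset.range N, n * q n ≤ 2 * C * x ^ 2 := by
    have h1 : ∀ n ∈ Finset.range N, n * q n ≤ C * (1 / √((n : ℝ) + 1)) := by
      intro n _
      have hn : (0 : ℝ) < n + 1 := by positivity
      have hs : 0 < √((n : ℝ) + 1) := Real.sqrt_pos.2 hn
      have hs2 : √((n : ℝ) + 1) ^ 2 = n + 1 := Real.sq_sqrt hn.le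
      calc (n : ℝ) * q n ≤ (√((n : ℝ) + 1) ^ 2) * (C * (1 / √((n : ℝ) + 1) ^ 3)) := by
            gcongr
            · rw [hs2]; linarith
            · exact lineProb_toReal_le hC0 (hC n 0 0)
        _ = C * (1 / √((n : ℝ) + 1)) := by
            field_simp
    refine (Finset.sum_le_sum h1).trans ?_
    rw [← Finset.mul_sum]
    have h2 := sum_range_inv_sqrt_le N
    have h3 : √(N : ℝ) ≤ x ^ 2 := by
      refine Real.sqrt_le_iff.2 ⟨by positivity, ?_⟩
      linarith [pow_mul x 2 2]
    calc C * ∑ n ∈ Finset.range N, 1 / √((n : ℝ) + 1) ≤ C * (2 * x ^ 2) := by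
          gcongr
          linarith
      _ = 2 * C * x ^ 2 := by ring
  -- interaction of opposite sides at distance `H`
  have b4 : R.L * (∑ n ∈ Finset.range N, X n) ≤ 12 * C * x ^ 2 := by
    have h1 : ∑ n ∈ Finset.range N, X n ≤ 2 * C * (6 / x) := by
      have h2 : ∑ n ∈ Finset.range N, X n ≤
          ∑ n ∈ Finset.Ico R.H N, 2 * C * (1 / √((n : ℝ) + 1) ^ 3) := by
        simp only [hX, Finset.sum_ite, Finset.sum_const_zero, zero_add]
        refine Finset.sum_le_sum_of_subset_of_nonneg (fun n hn => ?_) fun _ _ _ => by positivity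
        simp only [Finset.mem_filter, Finset.mem_range, Finset.mem_Ico] at hn ⊢
        omega
      refine h2.trans ?_
      rw [← Finset.mul_sum]
      have h3 := sum_Ico_inv_sqrt_cube_le R.H N
      have h4 : x ≤ √((R.H : ℝ) + 1) := Real.le_sqrt_of_sq_le (by linarith [h.le_H])
      have h5 : 6 / √((R.H : ℝ) + 1) ≤ 6 / x := by gcongr
      exact mul_le_mul_of_nonneg_left (h3.trans h5) (by positivity)
    calc R.L * (∑ n ∈ Finset.range N, X n) ≤ R.L * (2 * C * (6 / x)) := by gcongr
      _ = 12 * C * x ^ 2 := by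
          rw [h.L_eq]
          field_simp
          ring
  -- interaction of opposite sides at distance `L`
  have b5 : N * (R.H * Y) ≤ 2 * (2 ^ 8 * 40320) * x ^ 2 := by
    have h1 : N * (R.H * Y) ≤ x ^ 4 * (x ^ 4 * Y) := by gcongr
    have h2 : x ^ 8 * Real.exp (-(x ^ 2 / 2)) ≤ x ^ 16 * Real.exp (-(x ^ 2 / 2)) := by
      gcongr
      norm_num
    have h3 := pow_mul_exp_neg_le (x := x)
    have h4 : (1 : ℝ) ≤ x ^ 2 := one_le_pow₀ hx
    have h5 : x ^ 4 * (x ^ 4 * Y) = 2 * (x ^ 8 * Real.exp (-(x ^ 2 / 2))) := by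
      rw [hY]
      ring
    nlinarith
  have b6 := mul_le_mul_of_nonneg_left b1 (Nat.cast_nonneg (α := ℝ) R.perimeter)
  rw [mul_add] at b6
  linarith

/-- Finite-volume form of the improved spin-wave estimate. -/
lemma exists_norm_integral_wilson_le : ∃ K : ℝ, ∀ β : ℝ, 0 < β → ∀ R : Rectangle,
    R.SufficientlySquare → ∀ (bc : BoundaryCondition) (j : ℕ), R.FarFromBoundary j R.L →
      ‖∫ θ, R.wilson θ ∂(villain β bc j)‖ ≤ Real.exp (-(cGFF.toReal / (2 * β) *
        (R.perimeter - K * (R.L : ℝ) ^ (2 / 3 : ℝ)))) := by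
  obtain ⟨K, hK⟩ := exists_energy_ge
  have hpos := cGFF_toReal_pos
  refine ⟨(K + 256 * (2 * (2 ^ 8 * 40320))) / cGFF.toReal, fun β hβ R hR bc j hj => ?_⟩
  obtain ⟨x, M, hs, hx⟩ := hR.exists_scale
  have hx1 := hs.one_le
  refine (norm_integral_wilson_le_energy hβ R bc hj M (l := 1 / x) (by positivity)).trans ?_
  rw [Real.exp_le_exp, neg_le_neg_iff, hx]
  have h1 := hK R x M hs
  have h2 := hs.cutoff_error_le
  have h3 : (1 : ℝ) ≤ x ^ 2 := one_le_pow₀ hx1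
  calc cGFF.toReal / (2 * β) * (R.perimeter -
        (K + 256 * (2 * (2 ^ 8 * 40320))) / cGFF.toReal * x ^ 2)
      = 1 / (2 * β) * (cGFF.toReal * R.perimeter - K * x ^ 2 -
          256 * (2 * (2 ^ 8 * 40320)) * x ^ 2) := by
        field_simp
        ring
    _ ≤ _ := by
        refine mul_le_mul_of_nonneg_left ?_ (by positivity)
        linarith

end Asymptotics

end VillainU1

theorem corollaryc :
    VillainU1.cGFF ≠ ∞ ∧
    (∀ β : ℝ, 0 < β → ∃ c : ℝ, 0 < c ∧ ∀ R : VillainU1.Rectangle,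
      ∀ bc : VillainU1.BoundaryCondition,
        (∀ j : ℕ, R.Allowed j bc →
          ‖∫ θ, R.wilson θ ∂(VillainU1.villain β bc j)‖ ≤ Real.exp (-(c * R.perimeter))) ∧
        (∀ P : Measure (VillainU1.Edge → ℝ), VillainU1.IsInfiniteVolumeVillain β bc P →
          ‖∫ θ, R.wilson θ ∂P‖ ≤ Real.exp (-(c * R.perimeter)))) ∧
    (∃ K : ℝ, ∀ β : ℝ, 0 < β → ∀ R : VillainU1.Rectangle, R.SufficientlySquare →
      ∀ bc : VillainU1.BoundaryCondition,
        (∀ j : ℕ, R.FarFromBoundary j R.L →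
          ‖∫ θ, R.wilson θ ∂(VillainU1.villain β bc j)‖ ≤
            Real.exp (-(VillainU1.cGFF.toReal / (2 * β) *
              (R.perimeter - K * (R.L : ℝ) ^ (2 / 3 : ℝ))))) ∧
        (∀ P : Measure (VillainU1.Edge → ℝ), VillainU1.IsInfiniteVolumeVillain β bc P →
          ‖∫ θ, R.wilson θ ∂P‖ ≤
            Real.exp (-(VillainU1.cGFF.toReal / (2 * β) *
              (R.perimeter - K * (R.L : ℝ) ^ (2 / 3 : ℝ)))))) := by
  refine ⟨VillainU1.cGFF_ne_top, fun β hβ => ⟨1 / (32 * β), by positivity, fun R bc =>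
    ⟨fun j hj => VillainU1.norm_integral_wilson_le_perimeter hβ R hj, fun P hP => ?_⟩⟩, ?_⟩
  · refine VillainU1.norm_integral_wilson_le_of_eventually hP R ?_
    filter_upwards [R.eventually_farFromBoundary 0] with j hj
    exact VillainU1.norm_integral_wilson_le_perimeter hβ R (hj.allowed bc)
  · obtain ⟨K, hK⟩ := VillainU1.exists_norm_integral_wilson_le
    refine ⟨K, fun β hβ R hR bc => ⟨hK β hβ R hR bc, fun P hP => ?_⟩⟩
    refine VillainU1.norm_integral_wilson_le_of_eventually hP R ?_
    filter_upwards [R.eventually_farFromBoundary R.L] with j hj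
    exact hK β hβ R hR bc j hj
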